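/- Conventions. Let $A,B$ be C$^*$-algebras. Hilbert C$^*$-modules are right modules, with inner products linear in the first variable; $\mathcal L(E,F)$ denotes the adjointable operators, and $B$ is a Hilbert $B$-module with $\langle b,c\rangle=c^*b$. A linear map $\rho:A\to M(B)$ is *completely positive* if $\sum_{i,j}b_j^*\rho(a_j^*a_i)b_i\ge 0$ for all $a_i\in A$, $b_i\in B$, and *strict* if it is strictly continuous on bounded sets; a strict completely positive $\rho$ extends uniquely to a linear map $M(A)\to M(B)$, again written $\rho$, that is strictly continuous on bounded sets. A *C$^*$-valued weight* $\varphi$ from $A$ into $M(B)$ consists of a hereditary cone $\mathcal M_\varphi^+\subseteq A^+$ and a linear map $\varphi:\mathcal M_\varphi=\operatorname{span}\mathcal M_\varphi^+\to M(B)$ with $\sum_{i,j}b_j^*\varphi(a_j^*a_i)b_i\ge0$ for all $a_i\in\mathcal N_\varphi=\{a\in A: a^*a\in\mathcal M_\varphi^+\}$ and $b_i\in B$. A *KSGNS-construction* $(E,\Lambda,\pi)$ for $\varphi$ consists of a Hilbert C$^*$-module $E$ over $B$, a linear map $\Lambda:\mathcal N_\varphi\to\mathcal L(B,E)$ such that the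 elements $\Lambda(a)b$ span a dense subspace of $E$ and $\langle\Lambda(a_1)b_1,\Lambda(a_2)b_2\rangle=b_2^*\varphi(a_2^*a_1)b_1$, and a $^*$-homomorphism $\pi:A\to\mathcal L(E)$ with $\pi(x)\Lambda(a)=\Lambda(xa)$. Let $\mathcal H_\varphi$ be the set of strict completely positive linear maps $\rho:A\to M(B)$ for which there is a (necessarily unique) $T_\rho\in\mathcal L(E)^+$ with $\langle T_\rho\Lambda(a_1)b_1,\Lambda(a_2)b_2\rangle=b_2^*\rho(a_2^*a_1)b_1$ for all $a_1,a_2\in\mathcal N_\varphi$, $b_1,b_2\in B$. Put $\mathcal F_\varphi=\{\rho\in\mathcal H_\varphi:T_\rho\le1\}$ and $\mathcal G_\varphi=\{\lambda\rho:\lambda\in[0,1),\ \rho\in\mathcal F_\varphi\}$, ordered by $\rho_1\le\rho_2$ iff $\rho_2-\rho_1$ is completely positive; when $\mathcal M_\varphi$ is dense in $A$, $\mathcal G_\varphi$ is directed. The weight $\varphi$ is *regular* if * $\mathcal M_\varphi$ is dense in $A$; * (lower semi-continuity) $\mathcal M_\varphi^+$ is the set of those $x\in A^+$ for which $(\rho(x))_{\rho\in\mathcal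 G_\varphi}$ converges strictly in $M(B)$, and the limit is then $\varphi(x)$; * (truncating net) there are a net $(u_i)_{i\in I}$ in $M(A)$ converging strictly to $1$, with $\|u_i\|\le1$ and $\mathcal N_\varphi u_i\subseteq\mathcal N_\varphi$, operators $S_i\in\mathcal L(E)$ with $\|S_i\|\le 1$, $S_i\Lambda(a)=\Lambda(au_i)$ for $a\in\mathcal N_\varphi$ and $S_i\to1$ strongly, and strict completely positive linear maps $\rho_i:A\to M(B)$ with $b_2^*\rho_i(a_2^*a_1)b_1=\langle S_i\Lambda(a_1)b_1,S_i\Lambda(a_2)b_2\rangle$ for all $a_1,a_2\in\mathcal N_\varphi$, $b_1,b_2\in B$. Let $\varphi$ be regular with KSGNS-construction $(E,\Lambda,\pi)$. Then $\pi$ is non-degenerate and thus extends to $M(A)$. For $\rho\in\mathcal H_\varphi$ let $v_\rho$ be the unique element of $\mathcal L(B,E)$ with $T_\rho^{1/2}\Lambda(c)=\pi(c)v_\rho$ for all $c\in\mathcal N_\varphi$. Let $\tilde{\mathcal N}_\varphi$ be the set of $a\in M(A)$ such that $\{b\in B:(b^*\rho(a^*a)b)_{\rho\in\mathcal G_\varphi}\text{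 converges in }B\}$ is dense in $B$. For $a\in\tilde{\mathcal N}_\varphi$ let $\Lambda(a)$ be the operator from within $B$ into $E$ whose domain $D(\Lambda(a))$ is the set of $b\in B$ for which $(\pi(a)v_\rho b)_{\rho\in\mathcal G_\varphi}$ converges in $E$, with $\Lambda(a)b$ equal to the limit. **Proposition.** Let $\varphi$ be a regular C$^*$-valued weight from $A$ into $M(B)$ with KSGNS-construction $(E,\Lambda,\pi)$, and let $a\in\tilde{\mathcal N}_\varphi$. Then $\Lambda(a)$ is well defined, and: 1. $D(\Lambda(a))=\{b\in B:(b^*\rho(a^*a)b)_{\rho\in\mathcal G_\varphi}\text{ converges in }B\}$. 2. Let $\rho\in\mathcal F_\varphi$ and $S\in\pi(A)'\cap\mathcal L(E)$ with $S^*S=T_\rho$. Then there is a unique $v\in\mathcal L(B,E)$ with $S\Lambda(c)=\pi(c)v$ for all $c\in\mathcal N_\varphi$, and $S\Lambda(a)b=\pi(a)vb$ for every $b\in D(\Lambda(a))$. 3. $\Lambda(a)$ is a closed, densely defined, $B$-linear map, and its adjoint $\Lambda(a)^*$ is densely defined. -/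

import Mathlib

open Filter Topology MultiplierAlgebra

noncomputable section

namespace CValued

/-! ### Hilbert modules and adjointable operators -/

/-- A (pre-)Hilbert module over the C*-algebra `B`: a *right* `B`-module `E` with a `B`-valued inner
product that is linear in the *first* variable, whose norm is `‖x‖ = ‖⟨x, x⟩‖ ^ (1/2)`.
It is a Hilbert C*-module as soon as `E` is complete.
(Mathlib's `CStarModule` has the scalars acting on the left.) -/
class HilbertModule (B E : Type*) [NonUnitalCStarAlgebra B] [PartialOrder B]
    [NormedAddCommGroup E] [NormedSpace ℂ E] where
  /-- the right action `x b` -/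
  act : E → B → E
  /-- the inner product `⟨x, y⟩` -/
  ip : E → E → B
  add_act : ∀ (x y : E) (b : B), act (x + y) b = act x b + act y b
  act_add : ∀ (x : E) (b c : B), act x (b + c) = act x b + act x c
  act_mul : ∀ (x : E) (b c : B), act x (b * c) = act (act x b) c
  smul_act : ∀ (z : ℂ) (x : E) (b : B), act (z • x) b = z • act x b
  act_smul : ∀ (z : ℂ) (x : E) (b : B), act x (z • b) = z • act x b
  ip_add_left : ∀ x y w : E, ip (x + y) w = ip x w + ip y w
  ip_smul_left : ∀ (z : ℂ) (x y : E), ip (z • x) y = z • ip x y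
  ip_act_left : ∀ (x y : E) (b : B), ip (act x b) y = ip x y * b
  star_ip : ∀ x y : E, star (ip x y) = ip y x
  ip_self_nonneg : ∀ x : E, 0 ≤ ip x x
  norm_sq : ∀ x : E, ‖x‖ ^ 2 = ‖ip x x‖

/-- A C*-algebra is a Hilbert C*-module over itself, with `⟨b, c⟩ = c* b`. -/
instance instHilbertModuleSelf (B : Type*) [NonUnitalCStarAlgebra B] [PartialOrder B]
    [StarOrderedRing B] : HilbertModule B B where
  act x b := x * b
  ip x y := star y * x
  add_act := add_mul
  act_add := mul_add
  act_mul x b c := (mul_assoc x b c).symm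
  smul_act z x b := smul_mul_assoc z x b
  act_smul z x b := mul_smul_comm z x b
  ip_add_left x y w := mul_add _ _ _
  ip_smul_left z x y := mul_smul_comm _ _ _
  ip_act_left x y b := (mul_assoc _ _ _).symm
  star_ip x y := by simp
  ip_self_nonneg x := star_mul_self_nonneg x
  norm_sq x := by rw [CStarRing.norm_star_mul_self, sq]

section Operators

variable (B : Type*) {E F : Type*} [NonUnitalCStarAlgebra B] [PartialOrder B]
  [NormedAddCommGroup E] [NormedSpace ℂ E] [HilbertModule B E]
  [NormedAddCommGroup F] [NormedSpace ℂ F] [HilbertModule B F]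

/-- `S` is an adjoint of `T`: `⟨T x, y⟩ = ⟨x, S y⟩`. -/
def AdjPair (T : E →L[ℂ] F) (S : F →L[ℂ] E) : Prop :=
  ∀ (x : E) (y : F), HilbertModule.ip (B := B) (T x) y = HilbertModule.ip (B := B) x (S y)

/-- `T` belongs to `𝓛(E, F)`, the set of adjointable operators. -/
def IsAdjointable (T : E →L[ℂ] F) : Prop := ∃ S : F →L[ℂ] E, AdjPair B T S

/-- `T` is a positive element of the C*-algebra `𝓛(E)`, i.e. `T = S* S` with `S ∈ 𝓛(E)`. -/
def IsPositiveOp (T : E →L[ℂ] E) : Prop :=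
  ∃ S S' : E →L[ℂ] E, AdjPair B S S' ∧ T = S' ∘L S

/-- The square root of a positive element `T` of `𝓛(E)`: the unique positive `R ∈ 𝓛(E)` with
`R² = T`. -/
def sqrtOp (T : E →L[ℂ] E) : E →L[ℂ] E :=
  Classical.epsilon fun R => IsPositiveOp B R ∧ R ∘L R = T

end Operators

/-! ### The strict topology and completely positive maps -/

section Maps

variable {A B : Type*} [NonUnitalCStarAlgebra A] [NonUnitalCStarAlgebra B]

/-- Strict convergence in the multiplier algebra: `m i b → m b` and `b m i → b m` in norm for
every `b ∈ B`. Here `m.fst b` is the product `m b` and `m.snd b` is the product `b m`. -/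
def StrictTendsto {ι : Type*} (f : ι → 𝓜(ℂ, B)) (l : Filter ι) (m : 𝓜(ℂ, B)) : Prop :=
  ∀ b : B, Tendsto (fun i => (f i).fst b) l (𝓝 (m.fst b)) ∧
    Tendsto (fun i => (f i).snd b) l (𝓝 (m.snd b))

/-- A linear map `A → M(B)` is strict if it is strictly continuous on bounded sets. -/
def IsStrict (ρ : A →ₗ[ℂ] 𝓜(ℂ, B)) : Prop :=
  ∀ (r : ℝ) (l : Filter A) (x : A), (∀ᶠ a in l, ‖a‖ ≤ r) →
    StrictTendsto (fun a : A => DoubleCentralizer.coe ℂ a) l (DoubleCentralizer.coe ℂ x) →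
    StrictTendsto ρ l (ρ x)

/-- `σ : M(A) → M(B)` is a linear extension of `ρ : A → M(B)` that is strictly continuous on
bounded sets. -/
def IsStrictExtension (ρ : A →ₗ[ℂ] 𝓜(ℂ, B)) (σ : 𝓜(ℂ, A) →ₗ[ℂ] 𝓜(ℂ, B)) : Prop :=
  (∀ a : A, σ (DoubleCentralizer.coe ℂ a) = ρ a) ∧
  ∀ (r : ℝ) (l : Filter 𝓜(ℂ, A)) (x : 𝓜(ℂ, A)), (∀ᶠ m in l, ‖m‖ ≤ r) →
    StrictTendsto (fun m : 𝓜(ℂ, A) => m) l x → StrictTendsto σ l (σ x)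

/-- The unique extension of a strict completely positive map `ρ : A → M(B)` to `M(A)`. -/
def strictExtension (ρ : A →ₗ[ℂ] 𝓜(ℂ, B)) : 𝓜(ℂ, A) →ₗ[ℂ] 𝓜(ℂ, B) :=
  Classical.epsilon (IsStrictExtension ρ)

variable [PartialOrder B]

/-- Complete positivity of a linear map `ρ : A → M(B)`: for all `a₁, …, aₙ ∈ A` and
`b₁, …, bₙ ∈ B` one has `∑ᵢⱼ bⱼ* ρ(aⱼ* aᵢ) bᵢ ≥ 0`. -/
def IsCP (ρ : A →ₗ[ℂ] 𝓜(ℂ, B)) : Prop :=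
  ∀ (n : ℕ) (a : Fin n → A) (b : Fin n → B),
    0 ≤ ∑ i, ∑ j, star (b j) * (ρ (star (a j) * a i)).fst (b i)

/-- The order on completely positive maps: `ρ₁ ≤ ρ₂` iff `ρ₂ - ρ₁` is completely positive. -/
def CPLe (ρ₁ ρ₂ : A →ₗ[ℂ] 𝓜(ℂ, B)) : Prop := IsCP (ρ₂ - ρ₁)

end Maps

/-! ### Hereditary cones and C*-valued weights -/

section Cone

variable (A : Type*) [NonUnitalCStarAlgebra A] [PartialOrder A]

/-- A hereditary cone `P` in `A⁺`. -/
structure HereditaryCone where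
  /-- the underlying set -/
  carrier : Set A
  nonneg : ∀ x ∈ carrier, 0 ≤ x
  zero_mem : (0 : A) ∈ carrier
  add_mem : ∀ x ∈ carrier, ∀ y ∈ carrier, x + y ∈ carrier
  smul_mem : ∀ r : ℝ, 0 ≤ r → ∀ x ∈ carrier, r • x ∈ carrier
  hereditary : ∀ x y : A, 0 ≤ x → x ≤ y → y ∈ carrier → x ∈ carrier

variable {A} [StarOrderedRing A]

namespace HereditaryCone

variable (P : HereditaryCone A)

/-- `M = span P`. -/
def spanM : Submodule ℂ A := Submodule.span ℂ P.carrier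

/-- The left ideal `N = {a ∈ A | a* a ∈ P}`. -/
def leftIdeal : Submodule ℂ A where
  carrier := {a | star a * a ∈ P.carrier}
  zero_mem' := by simpa using P.zero_mem
  add_mem' := by
    intro a b ha hb
    have h2 : (2 : ℝ) • (star a * a) + (2 : ℝ) • (star b * b) ∈ P.carrier :=
      P.add_mem _ (P.smul_mem 2 (by norm_num) _ ha) _ (P.smul_mem 2 (by norm_num) _ hb)
    refine P.hereditary _ _ (star_mul_self_nonneg _) ?_ h2
    rw [← sub_nonneg]
    have : (2 : ℝ) • (star a * a) + (2 : ℝ) • (star b * b) - star (a + b) * (a + b)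
        = star (a - b) * (a - b) := by
      simp only [two_smul, star_add, star_sub, add_mul, mul_add, sub_mul, mul_sub]
      abel
    rw [this]
    exact star_mul_self_nonneg _
  smul_mem' := by
    intro z a ha
    have h := P.smul_mem (Complex.normSq z) (Complex.normSq_nonneg z) _ ha
    have : star (z • a) * (z • a) = Complex.normSq z • (star a * a) := by
      rw [star_smul, smul_mul_smul_comm, Complex.star_def, ← Complex.normSq_eq_conj_mul_self]
      exact (RCLike.real_smul_eq_coe_smul (K := ℂ) _ _).symm
    simpa only [Set.mem_ofPred_eq, this] using h

theorem mem_leftIdeal {a : A} : a ∈ P.leftIdeal ↔ star a * a ∈ P.carrier := Iff.rfl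

theorem mul_mem_leftIdeal (x : A) {a : A} (ha : a ∈ P.leftIdeal) : x * a ∈ P.leftIdeal := by
  rw [mem_leftIdeal] at ha ⊢
  refine P.hereditary _ _ (star_mul_self_nonneg _) ?_
    (P.smul_mem (‖star x * x‖) (norm_nonneg _) _ ha)
  have h := CStarAlgebra.star_left_conjugate_le_norm_smul (a := a) (b := star x * x)
    (IsSelfAdjoint.star_mul_self x)
  simpa only [star_mul, mul_assoc] using h

theorem star_mul_mem_spanM {a b : A} (ha : a ∈ P.leftIdeal) (hb : b ∈ P.leftIdeal) :
    star a * b ∈ P.spanM := by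
  have key : ∀ z : ℂ, z • (star (b + z • a) * (b + z • a)) ∈ P.spanM := fun z =>
    P.spanM.smul_mem z (Submodule.subset_span
      (P.leftIdeal.add_mem hb (P.leftIdeal.smul_mem z ha)))
  have h := P.spanM.smul_mem (4 : ℂ)⁻¹ (P.spanM.add_mem
    (P.spanM.add_mem (key 1) (key Complex.I))
    (P.spanM.add_mem (key (-1)) (key (-Complex.I))))
  convert h using 1
  simp only [star_add, star_smul, add_mul, mul_add, smul_mul_assoc, mul_smul_comm, smul_smul,
    smul_add]
  simp only [star_one, star_neg, Complex.star_def, Complex.conj_I]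
  match_scalars <;> ring_nf <;> norm_num [Complex.I_sq]

/-- The element `a* b` of `M`, for `a, b ∈ N`. -/
def starMul (a b : P.leftIdeal) : P.spanM := ⟨star (a : A) * b, P.star_mul_mem_spanM a.2 b.2⟩

/-- The element `x a` of `N`, for `x ∈ A` and `a ∈ N`. -/
def lmul (x : A) (a : P.leftIdeal) : P.leftIdeal := ⟨x * a, P.mul_mem_leftIdeal x a.2⟩

end HereditaryCone

variable (A) (B : Type*) [NonUnitalCStarAlgebra B] [PartialOrder B]

/-- A C*-valued weight `φ` from `A` into `M(B)`: a hereditary cone `P = 𝓜_φ⁺` in `A⁺` and a linear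
map `φ` from `𝓜_φ = span P` into `M(B)` with `∑ᵢⱼ bⱼ* φ(aⱼ* aᵢ) bᵢ ≥ 0` for all
`a₁, …, aₙ ∈ 𝓝_φ = {a | a* a ∈ P}` and `b₁, …, bₙ ∈ B`. -/
structure CStarWeight where
  /-- the hereditary cone `𝓜_φ⁺` -/
  cone : HereditaryCone A
  /-- the linear map `φ : 𝓜_φ → M(B)` -/
  toFun : cone.spanM →ₗ[ℂ] 𝓜(ℂ, B)
  positive : ∀ (n : ℕ) (a : Fin n → cone.leftIdeal) (b : Fin n → B),
    0 ≤ ∑ i, ∑ j, star (b j) * (toFun (cone.starMul (a j) (a i))).fst (b i)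

variable {A B}

/-- `𝓝_φ = {a ∈ A | a* a ∈ 𝓜_φ⁺}`. -/
abbrev CStarWeight.N (φ : CStarWeight A B) : Submodule ℂ A := φ.cone.leftIdeal

/-- `φ` is densely defined: `𝓜_φ` is dense in `A`. -/
def CStarWeight.DenselyDefined (φ : CStarWeight A B) : Prop := Dense (φ.cone.spanM : Set A)

end Cone

/-! ### KSGNS-constructions -/

section KSGNS

variable {A B : Type*} [NonUnitalCStarAlgebra A] [PartialOrder A] [StarOrderedRing A]
  [NonUnitalCStarAlgebra B] [PartialOrder B] [StarOrderedRing B]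

/-- A KSGNS-construction `(E, Λ, π)` for the C*-valued weight `φ`. -/
structure KSGNS (φ : CStarWeight A B) (E : Type*) [NormedAddCommGroup E] [NormedSpace ℂ E]
    [CompleteSpace E] [HilbertModule B E] where
  /-- the linear map `Λ : 𝓝_φ → 𝓛(B, E)` -/
  Λ : φ.N →ₗ[ℂ] (B →L[ℂ] E)
  adjointable : ∀ a, IsAdjointable B (Λ a)
  dense_range : Dense (Submodule.span ℂ {x : E | ∃ a b, x = Λ a b} : Set E)
  ip_eq : ∀ (a₁ a₂ : φ.N) (b₁ b₂ : B), HilbertModule.ip (B := B) (Λ a₁ b₁) (Λ a₂ b₂) =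
    star b₂ * (φ.toFun (φ.cone.starMul a₂ a₁)).fst b₁
  /-- the `*`-homomorphism `π : A → 𝓛(E)` -/
  π : A →ₙₐ[ℂ] (E →L[ℂ] E)
  π_star : ∀ x : A, AdjPair B (π x) (π (star x))
  π_Λ : ∀ (x : A) (a : φ.N) (b : B), π x (Λ a b) = Λ (φ.cone.lmul x a) b

namespace KSGNS

variable {φ : CStarWeight A B} {E : Type*} [NormedAddCommGroup E] [NormedSpace ℂ E]
  [CompleteSpace E] [HilbertModule B E] (K : KSGNS φ E)

/-- The extension of the (non-degenerate) `*`-homomorphism `π` to `M(A)`: `π(x)` is the unique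
element of `𝓛(E)` with `π(x) π(c) = π(x c)` for all `c ∈ A`. -/
def πM (x : 𝓜(ℂ, A)) : E →L[ℂ] E :=
  Classical.epsilon fun T : E →L[ℂ] E =>
    IsAdjointable B T ∧ ∀ c : A, T ∘L K.π c = K.π (x.fst c)

/-- `S ∈ π(A)'`. -/
def InCommutant (S : E →L[ℂ] E) : Prop := ∀ x : A, S ∘L K.π x = K.π x ∘L S

/-- `T ∈ 𝓛(E)⁺` with `⟨T Λ(a₁) b₁, Λ(a₂) b₂⟩ = b₂* ρ(a₂* a₁) b₁`. -/
def Represents (T : E →L[ℂ] E) (ρ : A →ₗ[ℂ] 𝓜(ℂ, B)) : Prop :=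
  IsPositiveOp B T ∧ ∀ (a₁ a₂ : φ.N) (b₁ b₂ : B),
    HilbertModule.ip (B := B) (T (K.Λ a₁ b₁)) (K.Λ a₂ b₂) =
      star b₂ * (ρ (star (a₂ : A) * (a₁ : A))).fst b₁

/-- `𝓗_φ`: the strict completely positive maps `ρ : A → M(B)` that are represented by an element
of `𝓛(E)⁺`. -/
def H : Set (A →ₗ[ℂ] 𝓜(ℂ, B)) := {ρ | IsStrict ρ ∧ IsCP ρ ∧ ∃ T, K.Represents T ρ}

/-- `T_ρ`, the unique element of `𝓛(E)⁺` that represents `ρ ∈ 𝓗_φ`. -/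
def T (ρ : A →ₗ[ℂ] 𝓜(ℂ, B)) : E →L[ℂ] E := Classical.epsilon fun T => K.Represents T ρ

/-- `𝓕_φ = {ρ ∈ 𝓗_φ | T_ρ ≤ 1}`. -/
def F : Set (A →ₗ[ℂ] 𝓜(ℂ, B)) :=
  {ρ | ρ ∈ K.H ∧ IsPositiveOp B (ContinuousLinearMap.id ℂ E - K.T ρ)}

/-- `𝓖_φ = {λ ρ | λ ∈ [0, 1[, ρ ∈ 𝓕_φ}`. -/
def G : Set (A →ₗ[ℂ] 𝓜(ℂ, B)) :=
  {ρ | ∃ t : ℝ, 0 ≤ t ∧ t < 1 ∧ ∃ η ∈ K.F, ρ = (t : ℂ) • η}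

/-- The filter of tails `{ρ ∈ 𝓖_φ | ρ₀ ≤ ρ}`, `ρ₀ ∈ 𝓖_φ`. As `𝓖_φ` is directed, a net
`(f ρ)_{ρ ∈ 𝓖_φ}` converges to `y` iff `f` tends to `y` along this filter. -/
def net : Filter (A →ₗ[ℂ] 𝓜(ℂ, B)) := ⨅ ρ₀ ∈ K.G, 𝓟 {ρ | ρ ∈ K.G ∧ CPLe ρ₀ ρ}

/-- `v ∈ 𝓛(B, E)` with `S Λ(c) = π(c) v` for every `c ∈ 𝓝_φ`. -/
def Implements (S : E →L[ℂ] E) (v : B →L[ℂ] E) : Prop :=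
  IsAdjointable B v ∧ ∀ c : φ.N, S ∘L K.Λ c = K.π c ∘L v

/-- `v_ρ`, the unique element of `𝓛(B, E)` with `T_ρ^{1/2} Λ(c) = π(c) v_ρ` for `c ∈ 𝓝_φ`. -/
def v (ρ : A →ₗ[ℂ] 𝓜(ℂ, B)) : B →L[ℂ] E :=
  Classical.epsilon fun v => K.Implements (sqrtOp B (K.T ρ)) v

/-- Lower semi-continuity of `φ`: `𝓜_φ⁺` consists of the `x ∈ A⁺` for which `(ρ(x))_{ρ ∈ 𝓖_φ}`
converges strictly in `M(B)`, and the limit is then `φ(x)`. -/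
def LowerSemicontinuous : Prop :=
  (φ.cone.carrier = {x : A | 0 ≤ x ∧ ∃ m, StrictTendsto (fun ρ => ρ x) K.net m}) ∧
  ∀ (x : A) (hx : x ∈ φ.cone.carrier),
    StrictTendsto (fun ρ => ρ x) K.net (φ.toFun ⟨x, Submodule.subset_span hx⟩)

/-- `(u i)_{i ∈ I}` is a truncating net for `φ`. Here `(u i).snd a` is the product `a uᵢ`. -/
def IsTruncatingNet {I : Type*} [Preorder I] (u : I → 𝓜(ℂ, A)) : Prop :=
  ∃ (hN : ∀ (i : I) (a : φ.N), (u i).snd (a : A) ∈ φ.N) (S : I → (E →L[ℂ] E)),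
    (∀ i, IsAdjointable B (S i)) ∧
    (∀ (i : I) (a : φ.N), S i ∘L K.Λ a = K.Λ ⟨(u i).snd (a : A), hN i a⟩) ∧
    (∀ i, ‖u i‖ ≤ 1) ∧ (∀ i, ‖S i‖ ≤ 1) ∧
    (∀ i, ∃ ρ : A →ₗ[ℂ] 𝓜(ℂ, B), IsStrict ρ ∧ IsCP ρ ∧ ∀ (a₁ a₂ : φ.N) (b₁ b₂ : B),
      star b₂ * (ρ (star (a₂ : A) * (a₁ : A))).fst b₁ =
        HilbertModule.ip (B := B) (S i (K.Λ a₁ b₁)) (S i (K.Λ a₂ b₂))) ∧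
    StrictTendsto u atTop 1 ∧
    (∀ x : E, Tendsto (fun i => S i x) atTop (𝓝 x))

/-- `φ` is regular, with truncating net `u`. -/
structure IsRegular {I : Type*} [Preorder I] (u : I → 𝓜(ℂ, A)) : Prop where
  denselyDefined : φ.DenselyDefined
  lowerSemicontinuous : K.LowerSemicontinuous
  truncating : K.IsTruncatingNet u

/-- The set of `b ∈ B` for which `(b* ρ(x) b)_{ρ ∈ 𝓖_φ}` converges in `B`, where `x ∈ M(A)`. -/
def convSet (x : 𝓜(ℂ, A)) : Set B :=
  {b | ∃ y : B, Tendsto (fun ρ => star b * (strictExtension ρ x).fst b) K.net (𝓝 y)}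

/-- `Ñ_φ`: the set of `a ∈ M(A)` such that `{b | (b* ρ(a* a) b)_{ρ ∈ 𝓖_φ} converges}` is dense
in `B`. -/
def Ntilde : Set 𝓜(ℂ, A) := {a | Dense (K.convSet (star a * a))}

/-- The set of pairs `(b, y)` such that `(π(a) v_ρ b)_{ρ ∈ 𝓖_φ}` converges to `y`. -/
def ΛtildeGraph (a : 𝓜(ℂ, A)) : Submodule ℂ (B × E) where
  carrier := {p | Tendsto (fun ρ => K.πM a (K.v ρ p.1)) K.net (𝓝 p.2)}
  zero_mem' := by simpa using tendsto_const_nhds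
  add_mem' := by
    intro p q hp hq
    simpa using Tendsto.add hp hq
  smul_mem' := by
    intro z p hp
    simpa using Tendsto.const_smul hp z

/-- The operator `Λ(a)` from within `B` into `E`: its domain is the set of `b ∈ B` for which
`(π(a) v_ρ b)_{ρ ∈ 𝓖_φ}` converges in `E`, and `Λ(a) b` is then the limit. -/
def Λtilde (a : 𝓜(ℂ, A)) : B →ₗ.[ℂ] E := (K.ΛtildeGraph a).toLinearPMap

theorem mem_Λtilde_domain (a : 𝓜(ℂ, A)) (b : B) :
    b ∈ (K.Λtilde a).domain ↔ ∃ y : E, Tendsto (fun ρ => K.πM a (K.v ρ b)) K.net (𝓝 y) := by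
  constructor
  · rintro ⟨p, hp, rfl⟩
    exact ⟨p.2, hp⟩
  · rintro ⟨y, hy⟩
    exact ⟨(b, y), hy, rfl⟩

/-- The domain of the adjoint of `Λ(a)`: those `x ∈ E` for which there is `c ∈ B` with
`⟨Λ(a) b, x⟩ = ⟨b, c⟩` for every `b` in the domain of `Λ(a)`. -/
def adjointDomain (a : 𝓜(ℂ, A)) : Set E :=
  {x | ∃ c : B, ∀ b : (K.Λtilde a).domain,
    HilbertModule.ip (B := B) (K.Λtilde a b) x = HilbertModule.ip (B := B) (b : B) c}

end KSGNS

end KSGNS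

end CValued

end

/-! For general `a` in `M(A)`, the vector `π(a) v_ρ b` plays the role of `T_ρ^{1/2} Λ(a) b`. It is
the limit of `T_ρ^{1/2} Λ(a n) b` as `n` runs through an approximate unit taken from `𝓝_φ`
(`tendsto_Λ_mulN`), so estimates between operators, tested on the honest vectors `x = Λ(a n) b`,
pass to the limit. Write `h_ρ` for this half vector and `f_ρ = T_ρ^{1/2} h_ρ` for the full vector,
formally `T_ρ Λ(a) b`. Since `b* ρ(a* a) b = ⟨h_ρ, h_ρ⟩` (`star_mul_strictExtension`), the task is
to turn convergence of these squares into convergence of the vectors.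

For `ρ ≤ η` in `𝓖_φ` the operator `D = T_η - T_ρ` satisfies `0 ≤ D ≤ 1`, hence `D² ≤ D` and `‖f_η -
f_ρ‖² ≤ ‖⟨h_η, h_η⟩ - ⟨h_ρ, h_ρ⟩‖`. So the full vectors form a Cauchy net. To compare `h_ρ` with
`f_ρ`, the defect `⟨(1 - T_ρ) h_ρ, h_ρ⟩`, formally `⟨(T_ρ - T_ρ²) x, x⟩`, has to tend to zero. The
directedness of `𝓖_φ` is therefore proved quantitatively: the operator monotone function `x / (1 +
x)` yields some `η ≥ ρ` with `T_η ≥ T_ρ + (T_ρ - T_ρ²) / 3` (`exists_upper_bound_G`), so the defect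
is at most three times an increment of the convergent net (`norm_ip_halfVec_le`). This gives the
domain.

If `S* S = T_ρ`, then `T_ρ ≤ 2 T_η` for large `η`, and `π(a) v b - S f_η`, formally `S (1 - T_η)
Λ(a) b`, is controlled by the same defect (`apply_limit_halfVec`). In particular `T_ρ^{1/2} Λ(a) b =
π(a) v_ρ b` for `ρ` in `𝓖_φ`. The truncating net gives `T_ρ^{1/2} → 1` strongly, so the graph of
`Λ(a)` is cut out by these closed conditions, and the vectors `T_ρ^{1/2} x` form a dense part of the
domain of the adjoint.

The functionals and intertwiners come from one principle: if `S` commutes with `π(A)` and `S* S ≤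
T_η`, strictness of `η` makes `S Λ(·) b` continuous enough for `S Λ(n) b` to converge to some `v b`
with `S Λ(c) = π(c) v` (`exists_implements`). -/

namespace CValued

/-! ### Inner products and adjoints on Hilbert modules -/

section HilbertModuleBasics

variable {B E F : Type*} [NonUnitalCStarAlgebra B] [PartialOrder B]
  [NormedAddCommGroup E] [NormedSpace ℂ E] [HilbertModule B E]
  [NormedAddCommGroup F] [NormedSpace ℂ F] [HilbertModule B F]

open HilbertModule

local notation "⟪" x ", " y "⟫" => HilbertModule.ip (B := B) x y

theorem ip_add_right (x y z : E) : ⟪x, y + z⟫ = ⟪x, y⟫ + ⟪x, z⟫ := by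
  rw [← star_ip, ip_add_left, star_add, star_ip, star_ip]

theorem ip_smul_right (c : ℂ) (x y : E) : ⟪x, c • y⟫ = star c • ⟪x, y⟫ := by
  rw [← star_ip, ip_smul_left, star_smul, star_ip]

theorem ip_act_right (x y : E) (b : B) : ⟪x, act y b⟫ = star b * ⟪x, y⟫ := by
  rw [← star_ip, ip_act_left, star_mul, star_ip]

theorem ip_zero_left (x : E) : ⟪0, x⟫ = 0 := by
  simpa using ip_smul_left (B := B) 0 (0 : E) x

theorem ip_zero_right (x : E) : ⟪x, 0⟫ = 0 := by
  rw [← star_ip, ip_zero_left, star_zero]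

theorem ip_neg_left (x y : E) : ⟪-x, y⟫ = -⟪x, y⟫ := by
  simpa using ip_smul_left (B := B) (-1) x y

theorem ip_neg_right (x y : E) : ⟪x, -y⟫ = -⟪x, y⟫ := by
  rw [← star_ip, ip_neg_left, star_neg, star_ip]

theorem ip_sub_left (x y z : E) : ⟪x - y, z⟫ = ⟪x, z⟫ - ⟪y, z⟫ := by
  rw [sub_eq_add_neg, ip_add_left, ip_neg_left, sub_eq_add_neg]

theorem ip_sub_right (x y z : E) : ⟪x, y - z⟫ = ⟪x, y⟫ - ⟪x, z⟫ := by
  rw [sub_eq_add_neg, ip_add_right, ip_neg_right, sub_eq_add_neg]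

theorem ip_sum_left {ι : Type*} (s : Finset ι) (f : ι → E) (y : E) :
    ⟪∑ i ∈ s, f i, y⟫ = ∑ i ∈ s, ⟪f i, y⟫ :=
  map_sum (⟨⟨fun x => ⟪x, y⟫, ip_zero_left y⟩, fun x z => ip_add_left x z y⟩ : E →+ B) f s

theorem ip_sum_right {ι : Type*} (s : Finset ι) (f : ι → E) (y : E) :
    ⟪y, ∑ i ∈ s, f i⟫ = ∑ i ∈ s, ⟪y, f i⟫ :=
  map_sum (⟨⟨fun x => ⟪y, x⟫, ip_zero_right y⟩, fun x z => ip_add_right y x z⟩ : E →+ B) f s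

theorem eq_zero_of_ip_self {x : E} (h : ⟪x, x⟫ = 0) : x = 0 := by
  have := norm_sq (B := B) x
  rw [h, norm_zero] at this
  simpa using this

theorem eq_of_forall_ip {x y : E} (h : ∀ z, ⟪x, z⟫ = ⟪y, z⟫) : x = y := by
  rw [← sub_eq_zero]
  apply eq_zero_of_ip_self (B := B)
  rw [ip_sub_left, h, sub_self]

variable [StarOrderedRing B]

variable (B) in
/-- The Cauchy-Schwarz inequality. -/
theorem norm_ip_le (x y : E) : ‖⟪x, y⟫‖ ≤ ‖x‖ * ‖y‖ := by
  by_cases hy : y = 0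
  · simp [hy, ip_zero_right]
  set b := ⟪x, y⟫ with hb
  set s : ℝ := ‖y‖ ^ 2 with hs
  have hs0 : 0 < s := by positivity
  have hbs : ⟪y, x⟫ = star b := by rw [hb, star_ip]
  -- The residual of projecting `x` onto `y`, multiplied by `s = ‖y‖²` to avoid dividing by `⟨y,
  -- y⟩`.
  have h1 := ip_self_nonneg (B := B) ((s : ℂ) • x - act y b)
  have h2 : star b * ⟪y, y⟫ * b ≤ s • (star b * b) := by
    rw [hs, norm_sq (B := B)]
    exact CStarAlgebra.star_left_conjugate_le_norm_smul (IsSelfAdjoint.of_nonneg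
      (ip_self_nonneg (B := B) y))
  have h3 : ⟪(s : ℂ) • x - act y b, (s : ℂ) • x - act y b⟫ =
      (s * s) • ⟪x, x⟫ - s • (star b * b) - s • (star b * b) + star b * ⟪y, y⟫ * b := by
    simp only [ip_sub_left, ip_sub_right, ip_smul_left, ip_smul_right, ip_act_left, ip_act_right,
      hbs, ← hb, Complex.star_def, Complex.conj_ofReal, mul_smul_comm, mul_sub, mul_assoc]
    simp only [Complex.coe_smul, smul_sub, smul_smul]
    abel
  rw [h3] at h1
  have h4 : s • (star b * b) ≤ (s * s) • ⟪x, x⟫ := by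
    rw [← sub_nonneg]
    refine h1.trans ?_
    calc _ ≤ (s * s) • ⟪x, x⟫ - s • (star b * b) - s • (star b * b) + s • (star b * b) := by gcongr
      _ = _ := by abel
  have h5 := CStarAlgebra.norm_le_norm_of_nonneg_of_le
    (smul_nonneg hs0.le (star_mul_self_nonneg b)) h4
  rw [norm_smul, norm_smul, CStarRing.norm_star_mul_self, ← norm_sq, Real.norm_of_nonneg hs0.le,
    Real.norm_of_nonneg (by positivity), mul_assoc] at h5
  have h6 := le_of_mul_le_mul_left h5 hs0
  rw [hs, ← sq, ← mul_pow] at h6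
  rw [mul_comm]
  exact (pow_le_pow_iff_left₀ (norm_nonneg _) (by positivity) two_ne_zero).1 h6

omit [StarOrderedRing B] in
theorem norm_act_le (x : E) (b : B) : ‖act x b‖ ≤ ‖x‖ * ‖b‖ := by
  refine (pow_le_pow_iff_left₀ (norm_nonneg _) (by positivity) two_ne_zero).1 ?_
  rw [norm_sq (B := B), ip_act_left, ip_act_right, mul_pow, norm_sq (B := B)]
  calc _ ≤ ‖star b‖ * ‖⟪x, x⟫‖ * ‖b‖ := norm_mul₃_le
    _ = _ := by rw [norm_star]; ring

variable (B) in
theorem continuous_ip : Continuous fun p : E × E => ⟪p.1, p.2⟫ := by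
  let f : E →ₗ⋆[ℂ] E →L[ℂ] B := LinearMap.mk
    { toFun := fun y => LinearMap.mkContinuous
        { toFun := fun x => ⟪x, y⟫
          map_add' := fun a b => ip_add_left a b y
          map_smul' := fun c a => ip_smul_left c a y } ‖y‖
        (fun x => (norm_ip_le B x y).trans (mul_comm _ _).le)
      map_add' := fun a b => by ext x; exact ip_add_right x a b }
    (fun c a => by ext x; exact ip_smul_right c x a)
  let g : E →L⋆[ℂ] E →L[ℂ] B := f.mkContinuous 1 (fun y => by
    rw [one_mul]; exact ContinuousLinearMap.opNorm_le_bound _ (norm_nonneg _)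
      (fun x => (norm_ip_le B x y).trans (mul_comm _ _).le))
  exact (g.continuous.comp continuous_snd).clm_apply continuous_fst

variable (B) in
theorem _root_.Filter.Tendsto.ip {ι : Type*} {l : Filter ι} {f g : ι → E} {x y : E}
    (hf : Tendsto f l (𝓝 x)) (hg : Tendsto g l (𝓝 y)) :
    Tendsto (fun i => ⟪f i, g i⟫) l (𝓝 ⟪x, y⟫) :=
  ((continuous_ip B).tendsto (x, y)).comp (hf.prodMk_nhds hg)

variable (B) in
theorem _root_.Continuous.ip {X : Type*} [TopologicalSpace X] {f g : X → E}
    (hf : Continuous f) (hg : Continuous g) : Continuous fun x => ⟪f x, g x⟫ :=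
  (continuous_ip B).comp (hf.prodMk hg)

omit [StarOrderedRing B] in
theorem _root_.Filter.Tendsto.act {ι : Type*} {l : Filter ι} {f : ι → E} {x : E}
    (hf : Tendsto f l (𝓝 x)) (b : B) : Tendsto (fun i => act (f i) b) l (𝓝 (act x b)) := by
  let g : E →L[ℂ] E := LinearMap.mkContinuous
    { toFun := fun x => HilbertModule.act x b
      map_add' := fun x y => add_act x y b
      map_smul' := fun c x => smul_act c x b } ‖b‖
    (fun x => (norm_act_le x b).trans (mul_comm _ _).le)
  exact (g.continuous.tendsto x).comp hf

theorem eq_of_dense_ip {s : Set E} (hs : Dense (Submodule.span ℂ s : Set E)) {x y : E}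
    (h : ∀ z ∈ s, ⟪x, z⟫ = ⟪y, z⟫) : x = y := by
  apply eq_of_forall_ip (B := B)
  refine hs.induction (P := fun z => ⟪x, z⟫ = ⟪y, z⟫) (fun z hz => ?_) ?_
  · induction hz using Submodule.span_induction with
    | mem z hz => exact h z hz
    | zero => simp [ip_zero_right]
    | add z w _ _ h1 h2 => simp [ip_add_right, h1, h2]
    | smul c z _ h1 => simp [ip_smul_right, h1]
  · exact isClosed_eq (continuous_const.ip B continuous_id) (continuous_const.ip B continuous_id)

/-! ### Adjoint pairs -/

omit [StarOrderedRing B] in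
theorem AdjPair.symm {T : E →L[ℂ] F} {S : F →L[ℂ] E} (h : AdjPair B T S) : AdjPair B S T := by
  intro x y
  rw [← star_ip, ← h y x, star_ip]

omit [StarOrderedRing B] in
theorem AdjPair.unique {T : E →L[ℂ] F} {S S' : F →L[ℂ] E} (h : AdjPair B T S)
    (h' : AdjPair B T S') : S = S' := by
  ext y
  apply eq_of_forall_ip (B := B)
  intro z
  rw [← star_ip, ← h, h', star_ip]

omit [StarOrderedRing B] in
theorem AdjPair.map_act {T : E →L[ℂ] F} {S : F →L[ℂ] E} (h : AdjPair B T S) (x : E) (b : B) :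
    T (act x b) = act (T x) b := by
  apply eq_of_forall_ip (B := B)
  intro z
  rw [h, ip_act_left, ip_act_left, h]

omit [StarOrderedRing B] in
theorem AdjPair.comp {G : Type*} [NormedAddCommGroup G] [NormedSpace ℂ G] [HilbertModule B G]
    {T : E →L[ℂ] F} {S : F →L[ℂ] E} {T' : F →L[ℂ] G} {S' : G →L[ℂ] F}
    (h' : AdjPair B T' S') (h : AdjPair B T S) : AdjPair B (T' ∘L T) (S ∘L S') := by
  intro x y
  simp only [ContinuousLinearMap.comp_apply]
  rw [h', h]

omit [StarOrderedRing B] in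
theorem AdjPair.norm_sq_apply {T : E →L[ℂ] F} {S : F →L[ℂ] E} (h : AdjPair B T S) (x : E) :
    ‖T x‖ ^ 2 = ‖⟪S (T x), x⟫‖ := by
  rw [norm_sq (B := B), ← h.symm]

/-- A bounded operator is adjointable as soon as it has an adjoint on a set of vectors with dense
span. -/
theorem isAdjointable_of_dense [CompleteSpace E] (T : E →L[ℂ] F) {s : Set F}
    (hs : Dense (Submodule.span ℂ s : Set F)) (h : ∀ y ∈ s, ∃ z : E, ∀ x, ⟪T x, y⟫ = ⟪x, z⟫) :
    IsAdjointable B T := by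
  let W : Submodule ℂ F :=
    { carrier := {y | ∃ z : E, ∀ x, ⟪T x, y⟫ = ⟪x, z⟫}
      zero_mem' := ⟨0, fun x => by simp [ip_zero_right]⟩
      add_mem' := by
        rintro a b ⟨z, hz⟩ ⟨w, hw⟩
        exact ⟨z + w, fun x => by rw [ip_add_right, ip_add_right, hz, hw]⟩
      smul_mem' := by
        rintro c a ⟨z, hz⟩
        exact ⟨c • z, fun x => by rw [ip_smul_right, ip_smul_right, hz]⟩ }
  -- Evaluating at `x = z` bounds `‖z‖²`. The adjoint vectors of a convergent sequence are then
  -- Cauchy, so `W` is closed.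
  have bound : ∀ (y : F) (z : E), (∀ x, ⟪T x, y⟫ = ⟪x, z⟫) → ‖z‖ ≤ ‖T‖ * ‖y‖ := by
    intro y z hz
    by_cases h0 : z = 0
    · rw [h0, norm_zero]; positivity
    have h1 : ‖z‖ * ‖z‖ ≤ (‖T‖ * ‖y‖) * ‖z‖ := by
      rw [← sq, norm_sq (B := B), ← hz]
      refine (norm_ip_le B _ _).trans ?_
      nlinarith [T.le_opNorm z, norm_nonneg y]
    exact le_of_mul_le_mul_right h1 (norm_pos_iff.2 h0)
  have hsW : Submodule.span ℂ s ≤ W := Submodule.span_le.2 h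
  have hW : ∀ y, y ∈ W := by
    intro y
    have hy : y ∈ closure (W : Set F) := (hs.mono hsW) y
    obtain ⟨u, hu, hlim⟩ := mem_closure_iff_seq_limit.1 hy
    choose z hz using hu
    have hc : CauchySeq z := by
      rw [Metric.cauchySeq_iff']
      have hcu := Metric.cauchySeq_iff'.1 hlim.cauchySeq
      intro ε hε
      obtain ⟨N, hN⟩ := hcu (ε / (‖T‖ + 1)) (by positivity)
      refine ⟨N, fun n hn => ?_⟩
      have := bound (u n - u N) (z n - z N)
        (fun x => by rw [ip_sub_right, ip_sub_right, hz, hz])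
      rw [dist_eq_norm]
      have h2 := hN n hn
      rw [dist_eq_norm, lt_div_iff₀ (by positivity)] at h2
      nlinarith [norm_nonneg (u n - u N)]
    obtain ⟨w, hw⟩ := cauchySeq_tendsto_of_complete hc
    refine ⟨w, fun x => tendsto_nhds_unique (f := fun n => ⟪T x, u n⟫) (l := atTop)
      (tendsto_const_nhds.ip B hlim) ?_⟩
    simp_rw [hz _ x]
    exact tendsto_const_nhds.ip B hw
  choose S hS using hW
  refine ⟨LinearMap.mkContinuous ⟨⟨S, fun a b => ?_⟩, fun c a => ?_⟩ ‖T‖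
    (fun y => bound y _ (hS y)), fun x y => hS y x⟩
  · apply eq_of_forall_ip (B := B)
    intro x
    rw [← star_ip, ← hS, ip_add_right, hS, hS, ← ip_add_right, star_ip]
  · apply eq_of_forall_ip (B := B)
    intro x
    rw [← star_ip, ← hS, ip_smul_right, hS, ← ip_smul_right, star_ip]
    rfl

end HilbertModuleBasics

/-! ### Strong limits of bounded nets of operators -/

section PointwiseLimits

/-- A bounded net of operators that is Cauchy on a total set converges pointwise to a bounded
operator. -/
theorem exists_pointwise_limit {ι X Y : Type*} [NormedAddCommGroup X] [NormedSpace ℂ X]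
    [NormedAddCommGroup Y] [NormedSpace ℂ Y] [CompleteSpace Y] {l : Filter ι} [l.NeBot]
    (f : ι → X →L[ℂ] Y) {C : ℝ} (hC : ∀ᶠ i in l, ‖f i‖ ≤ C) {s : Set X}
    (hs : Dense (Submodule.span ℂ s : Set X))
    (h : ∀ x ∈ s, Cauchy (map (fun i => f i x) l)) :
    ∃ T : X →L[ℂ] Y, ‖T‖ ≤ C ∧ ∀ x, Tendsto (fun i => f i x) l (𝓝 (T x)) := by
  have hC0 : 0 ≤ C := by
    obtain ⟨i, hi⟩ := hC.exists
    exact (norm_nonneg _).trans hi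
  have h1 : ∀ x ∈ Submodule.span ℂ s, ∃ y, Tendsto (fun i => f i x) l (𝓝 y) := by
    intro x hx
    induction hx using Submodule.span_induction with
    | mem x hx => exact CompleteSpace.complete (h x hx)
    | zero => exact ⟨0, by simp⟩
    | add x y _ _ hx hy =>
      obtain ⟨a, ha⟩ := hx
      obtain ⟨b, hb⟩ := hy
      exact ⟨a + b, by simpa using ha.add hb⟩
    | smul c x _ hx =>
      obtain ⟨a, ha⟩ := hx
      exact ⟨c • a, by simpa using ha.const_smul c⟩
  have h2 : ∀ x, ∃ y, Tendsto (fun i => f i x) l (𝓝 y) := by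
    intro x
    refine CompleteSpace.complete (Metric.cauchy_iff.2 ⟨inferInstance, fun ε hε => ?_⟩)
    obtain ⟨z, hz, hxz⟩ := Metric.dense_iff.1 hs x (ε / (4 * (C + 1))) (by positivity)
    obtain ⟨y, hy⟩ := h1 z hxz
    have hz' : ‖x - z‖ * (4 * (C + 1)) < ε := by
      rw [Metric.mem_ball, dist_comm, dist_eq_norm, lt_div_iff₀ (by positivity)] at hz
      exact hz
    refine ⟨Metric.ball y (ε / 2), ?_, fun a ha b hb => ?_⟩
    · rw [mem_map]
      filter_upwards [hC, hy (Metric.ball_mem_nhds y (by positivity : 0 < ε / 4))] with i hi hi'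
      simp only [Set.mem_preimage, Metric.mem_ball, dist_eq_norm] at hi' ⊢
      calc ‖f i x - y‖ = ‖f i (x - z) + (f i z - y)‖ := by rw [map_sub]; abel_nf
        _ ≤ ‖f i (x - z)‖ + ‖f i z - y‖ := norm_add_le _ _
        _ < ε / 2 := by
          have := (f i).le_of_opNorm_le hi (x - z)
          nlinarith [norm_nonneg (x - z)]
    · rw [Metric.mem_ball] at ha hb
      linarith [dist_triangle_right a b y]
  choose g hg using h2
  have hadd : ∀ x y, g (x + y) = g x + g y := fun x y => by
    refine tendsto_nhds_unique (hg (x + y)) ?_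
    simpa using (hg x).add (hg y)
  have hsmul : ∀ (c : ℂ) x, g (c • x) = c • g x := fun c x => by
    refine tendsto_nhds_unique (hg (c • x)) ?_
    simpa using (hg x).const_smul c
  have hb : ∀ x, ‖g x‖ ≤ C * ‖x‖ := fun x =>
    le_of_tendsto (hg x).norm (hC.mono fun i hi => (f i).le_of_opNorm_le hi x)
  exact ⟨LinearMap.mkContinuous ⟨⟨g, hadd⟩, hsmul⟩ C hb,
    LinearMap.mkContinuous_norm_le _ hC0 _, hg⟩

/-- Pointwise convergence of a bounded net of operators on a total set implies pointwise
convergence. -/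
theorem tendsto_of_dense {ι X Y : Type*} [NormedAddCommGroup X] [NormedSpace ℂ X]
    [NormedAddCommGroup Y] [NormedSpace ℂ Y] {l : Filter ι}
    {f : ι → X →L[ℂ] Y} {T : X →L[ℂ] Y} {C : ℝ} (hC : ∀ᶠ i in l, ‖f i‖ ≤ C) {s : Set X}
    (hs : Dense (Submodule.span ℂ s : Set X))
    (h : ∀ x ∈ s, Tendsto (fun i => f i x) l (𝓝 (T x))) (x : X) :
    Tendsto (fun i => f i x) l (𝓝 (T x)) := by
  have h1 : ∀ x ∈ Submodule.span ℂ s, Tendsto (fun i => f i x) l (𝓝 (T x)) := by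
    intro x hx
    induction hx using Submodule.span_induction with
    | mem x hx => exact h x hx
    | zero => simpa using tendsto_const_nhds
    | add x y _ _ hx hy => simpa using hx.add hy
    | smul c x _ hx => simpa using hx.const_smul c
  rw [Metric.tendsto_nhds]
  intro ε hε
  set D := |C| + ‖T‖ + 1
  have hD : 0 < D := by positivity
  obtain ⟨z, hz, hxz⟩ := Metric.dense_iff.1 hs x (ε / (2 * D)) (by positivity)
  have hz' : ‖x - z‖ * (2 * D) < ε := by
    rw [Metric.mem_ball, dist_comm, dist_eq_norm, lt_div_iff₀ (by positivity)] at hz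
    exact hz
  filter_upwards [hC, Metric.tendsto_nhds.1 (h1 z hxz) (ε / 2) (by positivity)] with i hi hi'
  rw [dist_eq_norm] at hi' ⊢
  calc ‖f i x - T x‖ = ‖f i (x - z) - T (x - z) + (f i z - T z)‖ := by
        rw [map_sub, map_sub]; abel_nf
    _ ≤ ‖f i (x - z)‖ + ‖T (x - z)‖ + ‖f i z - T z‖ :=
        (norm_add_le _ _).trans (by gcongr; exact norm_sub_le _ _)
    _ < ε := by
      have h1 := (f i).le_of_opNorm_le (hi.trans (le_abs_self C)) (x - z)
      have h2 := T.le_opNorm (x - z)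
      have h3 : (|C| + ‖T‖) * ‖x - z‖ ≤ D * ‖x - z‖ := by
        gcongr; simp [D]
      nlinarith

end PointwiseLimits

end CValued

namespace CValued

/-! ### The C*-algebra of adjointable operators -/

section AdjointableOperators

variable (B E : Type*) [NonUnitalCStarAlgebra B] [PartialOrder B]
  [NormedAddCommGroup E] [NormedSpace ℂ E] [HilbertModule B E]

open HilbertModule

local notation "⟪" x ", " y "⟫" => HilbertModule.ip (B := B) x y

/-- The algebra `𝓛(E)` of adjointable operators on `E`. -/
def adjointableSubalgebra : Subalgebra ℂ (E →L[ℂ] E) where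
  carrier := {T | IsAdjointable B T}
  mul_mem' := by
    rintro S T ⟨S', hS⟩ ⟨T', hT⟩
    exact ⟨T' ∘L S', hS.comp hT⟩
  add_mem' := by
    rintro S T ⟨S', hS⟩ ⟨T', hT⟩
    refine ⟨S' + T', fun x y => ?_⟩
    simp only [add_apply, ip_add_left, ip_add_right, hS x y, hT x y]
  algebraMap_mem' := by
    intro c
    refine ⟨star c • 1, fun x y => ?_⟩
    simp [Algebra.algebraMap_eq_smul_one, ip_smul_left, ip_smul_right]

/-- The C*-algebra `𝓛(E)` of adjointable operators on `E`. -/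
def AdjOp : Type _ := adjointableSubalgebra B E

noncomputable instance : NormedRing (AdjOp B E) :=
  inferInstanceAs (NormedRing (adjointableSubalgebra B E))

noncomputable instance : NormedAlgebra ℂ (AdjOp B E) :=
  inferInstanceAs (NormedAlgebra ℂ (adjointableSubalgebra B E))

variable {B E}

/-- An adjointable operator as an element of `𝓛(E)`. -/
def AdjOp.mk (T : E →L[ℂ] E) (h : IsAdjointable B T) : AdjOp B E := ⟨T, h⟩

theorem AdjOp.exists_adjoint (T : AdjOp B E) :
    ∃ S : AdjOp B E, AdjPair B T.1 S.1 := by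
  obtain ⟨S, hS⟩ := T.2
  exact ⟨AdjOp.mk S ⟨T.1, hS.symm⟩, hS⟩

noncomputable instance : Star (AdjOp B E) := ⟨fun T => (AdjOp.exists_adjoint T).choose⟩

theorem adjPair_star (T : AdjOp B E) :
    AdjPair B T.1 (star T).1 := (AdjOp.exists_adjoint T).choose_spec

theorem ip_apply_left (T : AdjOp B E) (x y : E) :
    ⟪T.1 x, y⟫ = ⟪x, (star T).1 y⟫ := adjPair_star T x y

theorem ip_apply_right (T : AdjOp B E) (x y : E) :
    ⟪x, T.1 y⟫ = ⟪(star T).1 x, y⟫ := ((adjPair_star T).symm x y).symm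

theorem star_eq_of_adjPair {T S : AdjOp B E} (h : AdjPair B T.1 S.1) :
    star T = S := Subtype.ext ((adjPair_star T).unique h)

theorem AdjOp.mul_apply (S T : AdjOp B E) (x : E) : (S * T).1 x = S.1 (T.1 x) := rfl

theorem AdjOp.add_apply (S T : AdjOp B E) (x : E) : (S + T).1 x = S.1 x + T.1 x := rfl

theorem AdjOp.sub_apply (S T : AdjOp B E) (x : E) : (S - T).1 x = S.1 x - T.1 x := rfl

theorem AdjOp.one_apply (x : E) : (1 : AdjOp B E).1 x = x := rfl

theorem AdjOp.zero_apply (x : E) : (0 : AdjOp B E).1 x = 0 := rfl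

theorem AdjOp.neg_apply (S : AdjOp B E) (x : E) : (-S).1 x = -S.1 x := rfl

theorem AdjOp.smul_apply (c : ℂ) (S : AdjOp B E) (x : E) :
    (c • S).1 x = c • S.1 x := rfl

theorem AdjOp.ext {S T : AdjOp B E} (h : ∀ x, S.1 x = T.1 x) : S = T :=
  Subtype.ext (ContinuousLinearMap.ext h)

theorem AdjOp.ext_ip {S T : AdjOp B E} (h : ∀ x y, ⟪S.1 x, y⟫ = ⟪T.1 x, y⟫) :
    S = T :=
  AdjOp.ext fun x => eq_of_forall_ip (B := B) (h x)

noncomputable instance : StarRing (AdjOp B E) where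
  star_involutive T := star_eq_of_adjPair (adjPair_star T).symm
  star_mul S T := star_eq_of_adjPair ((adjPair_star S).comp (adjPair_star T))
  star_add S T := star_eq_of_adjPair fun x y => by
    simp only [AdjOp.add_apply, ip_add_left, ip_add_right, ip_apply_left]

noncomputable instance : StarModule ℂ (AdjOp B E) where
  star_smul c T := star_eq_of_adjPair fun x y => by
    simp only [AdjOp.smul_apply, ip_smul_left, ip_smul_right, ip_apply_left, star_star]

variable [StarOrderedRing B]

theorem norm_apply_sq_le (T : AdjOp B E) (x : E) :
    ‖T.1 x‖ ^ 2 ≤ ‖star T * T‖ * ‖x‖ ^ 2 := by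
  rw [(adjPair_star T).norm_sq_apply, sq ‖x‖, ← mul_assoc]
  exact (norm_ip_le B _ _).trans
    (mul_le_mul_of_nonneg_right ((star T * T).1.le_opNorm x) (norm_nonneg _))

instance : CStarRing (AdjOp B E) where
  norm_mul_self_le T := by
    rw [← sq]
    refine (pow_le_pow_left₀ (norm_nonneg _) (ContinuousLinearMap.opNorm_le_bound T.1
      (Real.sqrt_nonneg ‖star T * T‖) fun x => ?_) 2).trans
      (Real.sq_sqrt (norm_nonneg (star T * T))).le
    refine (pow_le_pow_iff_left₀ (norm_nonneg _) (by positivity) two_ne_zero).1 ?_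
    rw [mul_pow, Real.sq_sqrt (norm_nonneg (star T * T))]
    exact norm_apply_sq_le T x

/-- The involution is isometric, so the adjoints of a norm-convergent sequence converge too, and
their limit is an adjoint of the limit. -/
instance [CompleteSpace E] : CompleteSpace (AdjOp B E) := by
  refine IsClosed.completeSpace_coe (s := (adjointableSubalgebra B E : Set (E →L[ℂ] E))) (hs := ?_)
  refine isClosed_of_closure_subset fun T hT => ?_
  obtain ⟨u, hu, hlim⟩ := mem_closure_iff_seq_limit.1 hT
  lift u to ℕ → adjointableSubalgebra B E using hu
  change ℕ → AdjOp B E at u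
  have hc : CauchySeq fun n => (star (u n)).1 := by
    have := hlim.cauchySeq
    rw [Metric.cauchySeq_iff] at this ⊢
    intro ε hε
    obtain ⟨N, hN⟩ := this ε hε
    refine ⟨N, fun m hm n hn => ?_⟩
    have h := hN m hm n hn
    rw [dist_eq_norm] at h ⊢
    have e : ‖star (u m - u n)‖ = ‖u m - u n‖ := norm_star _
    rw [star_sub] at e
    exact e.trans_lt h
  obtain ⟨S, hS⟩ := cauchySeq_tendsto_of_complete hc
  refine ⟨S, fun x y => tendsto_nhds_unique (f := fun n => ⟪(u n).1 x, y⟫) (l := atTop)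
    (Tendsto.ip B (((ContinuousLinearMap.apply ℂ E x).continuous.tendsto T).comp hlim)
      tendsto_const_nhds) ?_⟩
  simp_rw [ip_apply_left]
  exact Tendsto.ip B tendsto_const_nhds
    (((ContinuousLinearMap.apply ℂ E y).continuous.tendsto S).comp hS)

variable [CompleteSpace E]

noncomputable instance : CStarAlgebra (AdjOp B E) where

noncomputable instance : PartialOrder (AdjOp B E) := CStarAlgebra.spectralOrder _

instance : StarOrderedRing (AdjOp B E) := CStarAlgebra.spectralOrderedRing _

theorem isPositiveOp_iff {T : AdjOp B E} : IsPositiveOp B T.1 ↔ 0 ≤ T := by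
  rw [CStarAlgebra.nonneg_iff_eq_star_mul_self]
  constructor
  · rintro ⟨S, S', h, hT⟩
    refine ⟨AdjOp.mk S ⟨S', h⟩, Subtype.ext ?_⟩
    rw [star_eq_of_adjPair (T := AdjOp.mk S ⟨S', h⟩) (S := AdjOp.mk S' ⟨S, h.symm⟩) h]
    exact hT
  · rintro ⟨S, rfl⟩
    exact ⟨S.1, _, adjPair_star S, rfl⟩

theorem ip_nonneg {T : AdjOp B E} (hT : 0 ≤ T) (x : E) : 0 ≤ ⟪T.1 x, x⟫ := by
  obtain ⟨S, rfl⟩ := CStarAlgebra.nonneg_iff_eq_star_mul_self.1 hT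
  rw [AdjOp.mul_apply, ip_apply_left, star_star]
  exact ip_self_nonneg _

theorem ip_mono {S T : AdjOp B E} (h : S ≤ T) (x : E) : ⟪S.1 x, x⟫ ≤ ⟪T.1 x, x⟫ := by
  have := ip_nonneg (sub_nonneg.2 h) x
  rwa [AdjOp.sub_apply, ip_sub_left, sub_nonneg] at this

theorem norm_ip_mono {S T : AdjOp B E} (hS : 0 ≤ S) (h : S ≤ T) (x : E) :
    ‖⟪S.1 x, x⟫‖ ≤ ‖⟪T.1 x, x⟫‖ :=
  CStarAlgebra.norm_le_norm_of_nonneg_of_le (ip_nonneg hS x) (ip_mono h x)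

omit [StarOrderedRing B] [CompleteSpace E] in
/-- Polarization: an operator with vanishing quadratic form vanishes. -/
theorem eq_zero_of_ip_apply_self {T : AdjOp B E} (h : ∀ x, ⟪T.1 x, x⟫ = 0) : T = 0 := by
  refine AdjOp.ext_ip fun x y => ?_
  have h1 := h (x + y)
  have h2 := h (Complex.I • x + y)
  simp only [map_add, map_smul, ip_add_left, ip_add_right, ip_smul_left, ip_smul_right, h x, h y,
    smul_zero, zero_add, add_zero] at h1 h2
  rw [AdjOp.zero_apply, ip_zero_left]
  have h3 : Complex.I • (⟪T.1 x, y⟫ + ⟪T.1 y, x⟫) = 0 := by rw [add_comm, h1, smul_zero]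
  rw [smul_add] at h3
  have h4 : (2 * Complex.I) • ⟪T.1 x, y⟫ = 0 := by
    rw [Complex.star_def, Complex.conj_I, neg_smul] at h2
    rw [mul_smul, two_smul]
    have := congrArg₂ (· + ·) h2 h3
    simp only [add_zero] at this
    rw [← this]
    abel
  exact (smul_eq_zero.1 h4).resolve_left (by simp)

/-- Positivity of an adjointable operator is positivity of its quadratic form. -/
theorem nonneg_iff_forall_ip {T : AdjOp B E} : 0 ≤ T ↔ ∀ x, 0 ≤ ⟪T.1 x, x⟫ := by
  refine ⟨fun h x => ip_nonneg h x, fun h => ?_⟩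
  have hsa : IsSelfAdjoint T := by
    rw [isSelfAdjoint_iff, ← sub_eq_zero]
    refine eq_zero_of_ip_apply_self fun x => ?_
    rw [AdjOp.sub_apply, ip_sub_left, ← ip_apply_right, ← star_ip,
      (IsSelfAdjoint.of_nonneg (h x)).star_eq, sub_self]
  have hdec := CFC.posPart_sub_negPart T hsa
  have hmul : T * T⁻ = -(T⁻ * T⁻) := by
    nth_rw 1 [← hdec]
    rw [sub_mul, CFC.posPart_mul_negPart, zero_sub]
  have hneg : 0 ≤ T⁻ := CFC.negPart_nonneg T
  have hsn : star T⁻ = T⁻ := (IsSelfAdjoint.of_nonneg hneg).star_eq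
  -- Testing the form on `T⁻ x` shows that `-(T⁻)³` has nonnegative form as well, so the cube
  -- vanishes and with it `T⁻`.
  have hcube : 0 ≤ T⁻ * T⁻ * T⁻ := by
    have := star_left_conjugate_nonneg hneg T⁻
    rwa [hsn] at this
  have hz : T⁻ * T⁻ * T⁻ = 0 := by
    refine eq_zero_of_ip_apply_self fun x => le_antisymm ?_ (ip_nonneg hcube x)
    have h1 := h ((T⁻).1 x)
    rw [← AdjOp.mul_apply, ip_apply_right, hsn, ← AdjOp.mul_apply, hmul, mul_neg,
      AdjOp.neg_apply, ip_neg_left, ← mul_assoc] at h1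
    exact neg_nonneg.1 h1
  have hz2 : T⁻ * T⁻ = 0 := by
    rw [← CStarRing.star_mul_self_eq_zero_iff, star_mul, hsn, ← mul_assoc, hz, zero_mul]
  have hz3 : T⁻ = 0 := by
    rw [← CStarRing.star_mul_self_eq_zero_iff, hsn, hz2]
  rw [← hdec, hz3, sub_zero]
  exact CFC.posPart_nonneg T

omit [StarOrderedRing B] [CompleteSpace E] in
theorem norm_sq_apply (T : AdjOp B E) (x : E) :
    ‖T.1 x‖ ^ 2 = ‖⟪(star T * T).1 x, x⟫‖ := (adjPair_star T).norm_sq_apply x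

theorem mul_self_le_self {T : AdjOp B E} (h0 : 0 ≤ T) (h1 : T ≤ 1) : T * T ≤ T := by
  have hsq := CFC.sqrt_mul_sqrt_self T h0
  have h2 := star_left_conjugate_le_conjugate h1 (CFC.sqrt T)
  rw [(IsSelfAdjoint.of_nonneg (CFC.sqrt_nonneg T)).star_eq, mul_one, hsq] at h2
  refine le_trans (le_of_eq ?_) h2
  calc T * T = CFC.sqrt T * CFC.sqrt T * (CFC.sqrt T * CFC.sqrt T) := by rw [hsq]
    _ = CFC.sqrt T * (CFC.sqrt T * CFC.sqrt T) * CFC.sqrt T := by simp only [mul_assoc]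
    _ = CFC.sqrt T * T * CFC.sqrt T := by rw [hsq]

/-- Follows from `T² ≤ T`. This is the device that upgrades convergence of quadratic forms to norm
convergence of vectors. -/
theorem norm_sq_le_norm_ip {T : AdjOp B E} (h0 : 0 ≤ T) (h1 : T ≤ 1) (x : E) :
    ‖T.1 x‖ ^ 2 ≤ ‖⟪T.1 x, x⟫‖ := by
  have hs := (IsSelfAdjoint.of_nonneg h0).star_eq
  rw [norm_sq_apply]
  refine norm_ip_mono (star_mul_self_nonneg T) ?_ x
  rw [hs]
  exact mul_self_le_self h0 h1

theorem sqrt_sq_apply {T : AdjOp B E} (h : 0 ≤ T) (x : E) :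
    (CFC.sqrt T).1 ((CFC.sqrt T).1 x) = T.1 x := by
  rw [← AdjOp.mul_apply, CFC.sqrt_mul_sqrt_self T h]

theorem le_sqrt {T : AdjOp B E} (h0 : 0 ≤ T) (h1 : T ≤ 1) : T ≤ CFC.sqrt T := by
  have h2 : CFC.sqrt T ≤ 1 := by
    have := CFC.sqrt_le_sqrt T 1 h1
    rwa [CFC.sqrt_one] at this
  have h3 := mul_self_le_self (CFC.sqrt_nonneg T) h2
  rwa [CFC.sqrt_mul_sqrt_self T h0] at h3

theorem sqrt_le_one {T : AdjOp B E} (h1 : T ≤ 1) : CFC.sqrt T ≤ 1 := by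
  have := CFC.sqrt_le_sqrt T 1 h1
  rwa [CFC.sqrt_one] at this

/-- Since `T ≤ T^{1/2} ≤ 1`, one has `(1 - T^{1/2})² ≤ 1 - T^{1/2} ≤ 1 - T`. -/
theorem norm_sub_sqrt_sq_le {T : AdjOp B E} (h0 : 0 ≤ T) (h1 : T ≤ 1) (x : E) :
    ‖x - (CFC.sqrt T).1 x‖ ^ 2 ≤ ‖⟪(1 - T).1 x, x⟫‖ := by
  have h2 : 0 ≤ 1 - CFC.sqrt T := sub_nonneg.2 (sqrt_le_one h1)
  have h3 : 1 - CFC.sqrt T ≤ 1 := sub_le_self _ (CFC.sqrt_nonneg T)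
  refine (norm_sq_le_norm_ip h2 h3 x).trans (norm_ip_mono h2 ?_ x)
  exact sub_le_sub_left (le_sqrt h0 h1) 1

theorem norm_sub_apply_sq_le {T : AdjOp B E} (h0 : 0 ≤ T) (h1 : T ≤ 1) (x : E) :
    ‖x - T.1 x‖ ^ 2 ≤ ‖⟪(1 - T).1 x, x⟫‖ :=
  norm_sq_le_norm_ip (sub_nonneg.2 h1) (sub_le_self _ h0) x

/-- Uniqueness of positive square roots in the C*-algebra `𝓛(E)` identifies the chosen root with
that of the functional calculus. -/
theorem sqrtOp_eq {T : AdjOp B E} (hT : 0 ≤ T) : sqrtOp B T.1 = (CFC.sqrt T).1 := by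
  have hex : ∃ R : E →L[ℂ] E, IsPositiveOp B R ∧ R ∘L R = T.1 :=
    ⟨(CFC.sqrt T).1, isPositiveOp_iff.2 (CFC.sqrt_nonneg T),
      ContinuousLinearMap.ext (sqrt_sq_apply hT)⟩
  obtain ⟨hpos, h2⟩ : IsPositiveOp B (sqrtOp B T.1) ∧ sqrtOp B T.1 ∘L sqrtOp B T.1 = T.1 :=
    Classical.epsilon_spec hex
  obtain ⟨S, S', hS, hR⟩ := id hpos
  have hadj : IsAdjointable B (sqrtOp B T.1) := ⟨_, hR ▸ hS.symm.comp hS⟩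
  obtain ⟨R, hRe⟩ : ∃ R : AdjOp B E, R.1 = sqrtOp B T.1 := ⟨AdjOp.mk _ hadj, rfl⟩
  rw [← hRe] at hpos h2 ⊢
  rw [CFC.sqrt_unique (AdjOp.ext fun x => congrArg (fun S : E →L[ℂ] E => S x) h2)
    (isPositiveOp_iff.1 hpos)]

end AdjointableOperators

end CValued

namespace CValued

/-! ### The transform `x / (1 + x)` and quantitative upper bounds -/

section BoundedTransform

variable {D : Type*} [CStarAlgebra D] [PartialOrder D] [StarOrderedRing D]

/-- With `k = 2 / (1 - t)` one has `k (1 - x) ≥ 2` on `[0, t]`, and then the gain `k x / (1 + k x) -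
x = x (k (1 - x) - 1) / (1 + k x)` is at least `x (1 - x) / 3`. This surplus over `x` is what later
controls the defect. -/
theorem one_sub_one_add_inv_lower_bound {t x : ℝ} (ht : t < 1) (hx : 0 ≤ x) (hxt : x ≤ t) :
    x + 3⁻¹ * (x - x * x) ≤ 1 - (1 + 2 / (1 - t) * x)⁻¹ := by
  set k := 2 / (1 - t) with hk
  have hk0 : 0 < k := div_pos two_pos (by linarith)
  have hkx : 2 ≤ k * (1 - x) := by
    rw [hk, div_mul_eq_mul_div, le_div_iff₀ (by linarith)]
    linarith
  have hden : 0 < 1 + k * x := by positivity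
  have h1 : 1 - (1 + k * x)⁻¹ = k * x / (1 + k * x) := by field_simp; ring
  rw [h1, le_div_iff₀ hden]
  have h2 : 0 ≤ x * (2 - x) := mul_nonneg hx (by linarith)
  have h3 : 0 ≤ x * (1 - x / 3) := mul_nonneg hx (by linarith)
  nlinarith [mul_le_mul_of_nonneg_left hkx h3]

/-- The function `x / (1 + x)`. -/
noncomputable def boundedTransform (x : ℝ) : ℝ := 1 - (1 + x)⁻¹

theorem continuousOn_boundedTransform {s : Set ℝ} (hs : ∀ x ∈ s, 0 ≤ x) :
    ContinuousOn boundedTransform s := by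
  refine continuousOn_const.sub (ContinuousOn.inv₀ (by fun_prop) fun x hx => ?_)
  have := hs x hx
  positivity

theorem boundedTransform_zero : boundedTransform 0 = 0 := by simp [boundedTransform]

theorem boundedTransform_nonneg {x : ℝ} (hx : 0 ≤ x) : 0 ≤ boundedTransform x :=
  sub_nonneg.2 (inv_le_one_of_one_le₀ (by linarith))

theorem boundedTransform_lt_one {x : ℝ} (hx : 0 ≤ x) : boundedTransform x < 1 :=
  sub_lt_self _ (by positivity)

theorem boundedTransform_le_self {x : ℝ} (hx : 0 ≤ x) : boundedTransform x ≤ x := by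
  have h1 : boundedTransform x = x / (1 + x) := by rw [boundedTransform]; field_simp; ring
  rw [h1]
  exact div_le_self hx (by linarith)

theorem boundedTransform_mono {x y : ℝ} (hx : 0 ≤ x) (hxy : x ≤ y) :
    boundedTransform x ≤ boundedTransform y := by
  unfold boundedTransform
  gcongr

theorem lower_bound_boundedTransform {a : D} (ha : 0 ≤ a) {t : ℝ} (ht : t < 1)
    (hat : a ≤ algebraMap ℝ D t) :
    a + (3⁻¹ : ℝ) • (a - a * a) ≤ cfcₙ boundedTransform ((2 / (1 - t)) • a) := by
  set k := 2 / (1 - t) with hk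
  have hk0 : 0 < k := div_pos two_pos (by linarith)
  have hsa : IsSelfAdjoint a := IsSelfAdjoint.of_nonneg ha
  have hs0 : ∀ x ∈ spectrum ℝ a, 0 ≤ x := fun x hx => spectrum_nonneg_of_nonneg ha hx
  have hst : ∀ x ∈ spectrum ℝ a, x ≤ t := (le_algebraMap_iff_spectrum_le hsa).1 hat
  have himg : ∀ x ∈ (k • ·) '' spectrum ℝ a, 0 ≤ x := by
    rintro _ ⟨x, hx, rfl⟩
    exact smul_nonneg hk0.le (hs0 x hx)
  have hcont : ContinuousOn (fun x => boundedTransform (k • x)) (spectrum ℝ a) :=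
    (continuousOn_boundedTransform himg).comp (by fun_prop) (Set.mapsTo_image _ _)
  have e1 : cfcₙ boundedTransform (k • a) = cfc (fun x => boundedTransform (k • x)) a := by
    rw [cfcₙ_eq_cfc (hf := continuousOn_boundedTransform
      (quasispectrum_nonneg_of_nonneg _ (smul_nonneg hk0.le ha))) (hf0 := boundedTransform_zero),
      ← cfc_comp_smul k boundedTransform a (continuousOn_boundedTransform himg)]
  have e2 : a + (3⁻¹ : ℝ) • (a - a * a) = cfc (fun x : ℝ => x + 3⁻¹ * (x - x * x)) a := by
    rw [cfc_add (a := a) (fun x : ℝ => x) (fun x : ℝ => 3⁻¹ * (x - x * x)),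
      cfc_const_mul (3⁻¹ : ℝ) (fun x : ℝ => x - x * x) a,
      cfc_sub (a := a) (fun x : ℝ => x) (fun x : ℝ => x * x),
      cfc_mul (a := a) (fun x : ℝ => x) (fun x : ℝ => x), cfc_id' ℝ a]
  rw [e1, e2]
  exact cfc_mono (fun x hx => one_sub_one_add_inv_lower_bound ht (hs0 x hx) (hst x hx))
    (hg := hcont)

theorem boundedTransform_le_self_apply {r : D} (hr : 0 ≤ r) : cfcₙ boundedTransform r ≤ r := by
  have hq : ∀ x ∈ quasispectrum ℝ r, 0 ≤ x := quasispectrum_nonneg_of_nonneg r hr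
  conv_rhs => rw [← cfcₙ_id' ℝ r (IsSelfAdjoint.of_nonneg hr)]
  exact cfcₙ_mono (fun x hx => boundedTransform_le_self (hq x hx))
    (continuousOn_boundedTransform hq) continuousOn_id boundedTransform_zero rfl

theorem boundedTransform_le_algebraMap {r : D} (hr : 0 ≤ r) :
    cfcₙ boundedTransform r ≤ algebraMap ℝ D (boundedTransform ‖r‖) := by
  rcases subsingleton_or_nontrivial D with h | h
  · exact (Subsingleton.elim _ _).le
  rw [cfcₙ_eq_cfc (hf := continuousOn_boundedTransform (quasispectrum_nonneg_of_nonneg _ hr))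
    (hf0 := boundedTransform_zero)]
  exact cfc_le_algebraMap _ _ _ (fun x hx => boundedTransform_mono
    (spectrum_nonneg_of_nonneg hr hx) ((le_abs_self x).trans (spectrum.norm_le_norm_of_mem hx)))
    (continuousOn_boundedTransform fun x hx => spectrum_nonneg_of_nonneg hr hx)

/-- Two positive elements of norm less than one have a common upper bound of the same kind, which
is moreover dominated by a multiple of their sum. -/
theorem exists_upper_bound {a b : D} (ha : 0 ≤ a) (hb : 0 ≤ b) {t : ℝ} (ht : t < 1)
    (hat : a ≤ algebraMap ℝ D t) (hbt : b ≤ algebraMap ℝ D t) :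
    ∃ c : D, 0 ≤ c ∧ (∃ s : ℝ, 0 ≤ s ∧ s < 1 ∧ c ≤ algebraMap ℝ D s) ∧
      (∃ k : ℝ, 0 ≤ k ∧ c ≤ k • (a + b)) ∧
      a + (3⁻¹ : ℝ) • (a - a * a) ≤ c ∧ b + (3⁻¹ : ℝ) • (b - b * b) ≤ c ∧
      ∀ x, Commute a x → Commute b x → Commute c x := by
  set k := 2 / (1 - t) with hk
  have hk0 : 0 ≤ k := (div_pos two_pos (by linarith)).le
  have hr : 0 ≤ k • (a + b) := smul_nonneg hk0 (add_nonneg ha hb)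
  -- Operator monotonicity lets the transform of `k (a + b)` dominate those of `k a` and `k b`,
  -- although `a` and `b` need not commute.
  have hmono : MonotoneOn (cfcₙ boundedTransform) (Set.Ici (0 : D)) :=
    CFC.monotoneOn_one_sub_one_add_inv_real
  refine ⟨cfcₙ boundedTransform (k • (a + b)), ?_,
    ⟨_, boundedTransform_nonneg (norm_nonneg _), boundedTransform_lt_one (norm_nonneg _),
      boundedTransform_le_algebraMap hr⟩,
    ⟨k, hk0, boundedTransform_le_self_apply hr⟩, ?_, ?_, fun x hax hbx => ?_⟩
  · exact cfcₙ_nonneg fun x hx => boundedTransform_nonneg (quasispectrum_nonneg_of_nonneg _ hr x hx)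
  · exact (lower_bound_boundedTransform ha ht hat).trans (hmono (smul_nonneg hk0 ha) hr
      (smul_le_smul_of_nonneg_left (le_add_of_nonneg_right hb) hk0))
  · exact (lower_bound_boundedTransform hb ht hbt).trans (hmono (smul_nonneg hk0 hb) hr
      (smul_le_smul_of_nonneg_left (le_add_of_nonneg_left ha) hk0))
  · exact Commute.cfcₙ_real ((hax.add_left hbx).smul_left k) _

theorem commute_sqrt {a x : D} (h : Commute a x) : Commute (CFC.sqrt a) x :=
  Commute.cfcₙ_nnreal h _

end BoundedTransform

/-! ### Multipliers and strict continuity -/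

section Multipliers

variable {A : Type*} [NonUnitalCStarAlgebra A]

theorem eq_of_mul_left_eq {x y : A} (h : ∀ z : A, z * x = z * y) : x = y := by
  rw [← sub_eq_zero, ← CStarRing.star_mul_self_eq_zero_iff, mul_sub, h, sub_self]

theorem multiplier_fst_mul (m : 𝓜(ℂ, A)) (x y : A) : m.fst (x * y) = m.fst x * y :=
  eq_of_mul_left_eq fun z => by
    rw [← m.central, ← mul_assoc, m.central, mul_assoc]

theorem multiplier_snd_mul (m : 𝓜(ℂ, A)) (x y : A) : m.snd (x * y) = x * m.snd y := by
  refine star_injective (eq_of_mul_left_eq fun z => ?_)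
  apply star_injective
  simp only [star_mul, star_star]
  rw [m.central, mul_assoc, mul_assoc, m.central]

theorem multiplier_fst_ext {m n : 𝓜(ℂ, A)} (h : ∀ x, m.fst x = n.fst x) : m = n := by
  refine DoubleCentralizer.ext ℂ A m n (Prod.ext (ContinuousLinearMap.ext h)
    (ContinuousLinearMap.ext fun x => ?_))
  refine star_injective (eq_of_mul_left_eq fun z => star_injective ?_)
  simp only [star_mul, star_star]
  exact (m.central _ _).trans ((congrArg _ (h _)).trans (n.central _ _).symm)

theorem strictTendsto_coe_iff {ι : Type*} {f : ι → A} {l : Filter ι} {x : A} :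
    StrictTendsto (fun i => DoubleCentralizer.coe ℂ (f i)) l (DoubleCentralizer.coe ℂ x) ↔
      ∀ c : A, Tendsto (fun i => f i * c) l (𝓝 (x * c)) ∧
        Tendsto (fun i => c * f i) l (𝓝 (c * x)) := Iff.rfl

theorem StrictTendsto.coe_of_tendsto {ι : Type*} {f : ι → A} {l : Filter ι} {x : A}
    (h : Tendsto f l (𝓝 x)) :
    StrictTendsto (fun i => DoubleCentralizer.coe ℂ (f i)) l (DoubleCentralizer.coe ℂ x) :=
  strictTendsto_coe_iff.2 fun c => ⟨h.mul_const c, h.const_mul c⟩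

variable {B : Type*} [NonUnitalCStarAlgebra B]

theorem IsStrict.tendsto {ρ : A →ₗ[ℂ] 𝓜(ℂ, B)} (hρ : IsStrict ρ) {ι : Type*} {l : Filter ι}
    {f : ι → A} {x : A} {r : ℝ} (hr : ∀ᶠ i in l, ‖f i‖ ≤ r)
    (h : ∀ c : A, Tendsto (fun i => f i * c) l (𝓝 (x * c)) ∧
        Tendsto (fun i => c * f i) l (𝓝 (c * x))) (b : B) :
    Tendsto (fun i => (ρ (f i)).fst b) l (𝓝 ((ρ x).fst b)) :=
  tendsto_map'_iff.1 (hρ r (map f l) x hr (fun c =>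
    ⟨tendsto_map'_iff.2 (h c).1, tendsto_map'_iff.2 (h c).2⟩) b).1

theorem IsStrict.tendsto_of_norm {ρ : A →ₗ[ℂ] 𝓜(ℂ, B)} (hρ : IsStrict ρ) {ι : Type*}
    {l : Filter ι} {f : ι → A} {x : A} (h : Tendsto f l (𝓝 x)) (b : B) :
    Tendsto (fun i => (ρ (f i)).fst b) l (𝓝 ((ρ x).fst b)) := by
  have h1 : ∀ᶠ i in l, ‖f i‖ ≤ ‖x‖ + 1 :=
    (h.norm.eventually (gt_mem_nhds (lt_add_one _))).mono fun i => le_of_lt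
  exact hρ.tendsto h1 (strictTendsto_coe_iff.1 (StrictTendsto.coe_of_tendsto h)) b

theorem IsStrict.continuous {ρ : A →ₗ[ℂ] 𝓜(ℂ, B)} (hρ : IsStrict ρ) (b : B) :
    Continuous fun x => (ρ x).fst b :=
  continuous_iff_continuousAt.2 fun _ => hρ.tendsto_of_norm tendsto_id b

/-- Norm convergence implies bounded strict convergence, so `x ↦ ρ(x) b` is a bounded operator. -/
theorem IsStrict.exists_bound {ρ : A →ₗ[ℂ] 𝓜(ℂ, B)} (hρ : IsStrict ρ) (b : B) :
    ∃ C : ℝ, 0 ≤ C ∧ ∀ x, ‖(ρ x).fst b‖ ≤ C * ‖x‖ := by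
  let f : A →L[ℂ] B := ⟨⟨⟨fun x => (ρ x).fst b, fun x y => by simp⟩, fun c x => by simp⟩,
    hρ.continuous b⟩
  exact ⟨‖f‖, norm_nonneg _, f.le_opNorm⟩

end Multipliers

/-! ### The left ideal of a hereditary cone -/

section Ideals

variable {A : Type*} [NonUnitalCStarAlgebra A] [PartialOrder A] [StarOrderedRing A]

namespace HereditaryCone

variable (P : HereditaryCone A)

theorem exists_star_mul_self {p : A} (hp : p ∈ P.carrier) :
    ∃ q ∈ P.leftIdeal, star q * q = p := by
  have h : star (CFC.sqrt p) * CFC.sqrt p = p := by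
    rw [(IsSelfAdjoint.of_nonneg (CFC.sqrt_nonneg p)).star_eq,
      CFC.sqrt_mul_sqrt_self p (P.nonneg p hp)]
  exact ⟨_, P.mem_leftIdeal.2 (h.symm ▸ hp), h⟩

theorem spanM_le_span_star_mul :
    P.spanM ≤ Submodule.span ℂ {x | ∃ a₁ a₂ : P.leftIdeal, x = star (a₂ : A) * a₁} := by
  refine Submodule.span_mono fun p hp => ?_
  obtain ⟨q, hq, rfl⟩ := P.exists_star_mul_self hp
  exact ⟨⟨q, hq⟩, ⟨q, hq⟩, rfl⟩

/-- Each `p` in the cone is `q* q` with `q = p^{1/2}` in the left ideal. Density of `𝓜_φ` thus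
passes to `𝓝_φ`. -/
theorem spanM_le_leftIdeal : P.spanM ≤ P.leftIdeal := by
  refine Submodule.span_le.2 fun p hp => ?_
  obtain ⟨q, hq, rfl⟩ := P.exists_star_mul_self hp
  exact P.mul_mem_leftIdeal _ hq

/-- In `M(A)` the element `‖m* m‖ - m* m` has the form `n* n`, whence `(m a)* (m a) ≤ ‖m* m‖ a* a`,
and heredity applies. -/
theorem multiplier_mem_leftIdeal (m : 𝓜(ℂ, A)) {a : A} (ha : a ∈ P.leftIdeal) :
    m.fst a ∈ P.leftIdeal := by
  rw [mem_leftIdeal] at ha ⊢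
  have hmul : ∀ (n : 𝓜(ℂ, A)) (y z : A),
      star (n.fst y) * n.fst z = star y * (star n * n).fst z := fun n y z => by
    have h := (star n).central (star y) (n.fst z)
    rw [DoubleCentralizer.star_snd, star_star] at h
    rw [h, DoubleCentralizer.mul_fst]
    rfl
  obtain ⟨n, hn⟩ : ∃ n : 𝓜(ℂ, A), algebraMap ℝ 𝓜(ℂ, A) ‖star m * m‖ - star m * m = star n * n := by
    let _ := CStarAlgebra.spectralOrder 𝓜(ℂ, A)
    have _ := CStarAlgebra.spectralOrderedRing 𝓜(ℂ, A)
    exact CStarAlgebra.nonneg_iff_eq_star_mul_self.1 (sub_nonneg.2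
      (IsSelfAdjoint.le_algebraMap_norm_self (IsSelfAdjoint.star_mul_self m)))
  refine P.hereditary _ _ (star_mul_self_nonneg _) ?_ (P.smul_mem _ (norm_nonneg (star m * m)) _ ha)
  rw [← sub_nonneg]
  have h1 := star_mul_self_nonneg (n.fst a)
  rw [hmul, ← hn, DoubleCentralizer.sub_fst, sub_apply, mul_sub, ← hmul m,
    Algebra.algebraMap_eq_smul_one, DoubleCentralizer.smul_fst, DoubleCentralizer.one_fst] at h1
  simpa [mul_smul_comm] using h1

theorem dense_leftIdeal (hP : Dense (P.spanM : Set A)) : Dense (P.leftIdeal : Set A) :=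
  hP.mono P.spanM_le_leftIdeal

theorem dense_span_star_mul (hP : Dense (P.spanM : Set A)) :
    Dense (Submodule.span ℂ {x | ∃ a₁ a₂ : P.leftIdeal, x = star (a₂ : A) * a₁} : Set A) :=
  hP.mono P.spanM_le_span_star_mul

end HereditaryCone

end Ideals

end CValued

namespace CValued

/-! ### An approximate unit inside `𝓝_φ` -/

section ApproximateUnit

variable {A : Type*} [NonUnitalCStarAlgebra A] [PartialOrder A] [StarOrderedRing A]

open CStarAlgebra

/-- An approximate unit of `A` consisting of elements of a dense left ideal. -/
noncomputable def HereditaryCone.approxUnit (P : HereditaryCone A) : Filter P.leftIdeal :=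
  comap (fun n => (n : A)) (map (fun p : A × A => p.1 + p.2) (approximateUnit A ×ˢ 𝓝 0))

namespace HereditaryCone

variable (P : HereditaryCone A)

/-- The left ideal is dense, so it comes arbitrarily close to each member `e` of the approximate
unit, and pulling back the filter of sums `e + x` with `x → 0` leaves it proper. -/
theorem approxUnit_neBot (hP : Dense (P.spanM : Set A)) : P.approxUnit.NeBot := by
  have hne := (increasingApproximateUnit A).neBot
  refine comap_neBot fun t ht => ?_
  obtain ⟨t₁, h₁, t₂, h₂, h⟩ := mem_prod_iff.1 (mem_map.1 ht)
  obtain ⟨e, he⟩ := nonempty_of_mem h₁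
  obtain ⟨ε, hε, hb⟩ := Metric.mem_nhds_iff.1 h₂
  obtain ⟨n, hn, hnN⟩ := Metric.dense_iff.1 (P.dense_leftIdeal hP) e ε hε
  refine ⟨⟨n, hnN⟩, ?_⟩
  have := h (Set.mk_mem_prod he (hb (by simpa [dist_eq_norm] using hn : n - e ∈ Metric.ball 0 ε)))
  simpa using this

theorem approxUnit_mul_right (c : A) :
    Tendsto (fun n : P.leftIdeal => (n : A) * c) P.approxUnit (𝓝 c) := by
  refine Tendsto.comp (y := map (fun p : A × A => p.1 + p.2) (approximateUnit A ×ˢ 𝓝 0))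
    (g := fun x => x * c) (tendsto_map'_iff.2 ?_) tendsto_comap
  have h := (((increasingApproximateUnit A).tendsto_mul_right c).comp tendsto_fst).add
    ((tendsto_snd (f := approximateUnit A) (g := 𝓝 (0 : A))).mul_const c)
  simpa [Function.comp_def, add_mul] using h

theorem approxUnit_norm : ∀ᶠ n : P.leftIdeal in P.approxUnit, ‖(n : A)‖ ≤ 2 := by
  refine (tendsto_comap (f := fun n : P.leftIdeal => (n : A))).eventually
    (p := fun x => ‖x‖ ≤ 2) (eventually_map.2 ?_)
  have h : ∀ᶠ x in 𝓝 (0 : A), ‖x‖ < 1 := by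
    simpa using (continuous_norm.tendsto (0 : A)).eventually (gt_mem_nhds (by simp))
  filter_upwards [(increasingApproximateUnit A).eventually_norm.prod_mk h] with p hp
  linarith [norm_add_le p.1 p.2, hp.1, hp.2]

end HereditaryCone

end ApproximateUnit

/-! ### Dominated operators and their implementing maps -/

namespace KSGNS

variable {A B E : Type*} [NonUnitalCStarAlgebra A] [PartialOrder A] [StarOrderedRing A]
  [NonUnitalCStarAlgebra B] [PartialOrder B] [StarOrderedRing B]
  [NormedAddCommGroup E] [NormedSpace ℂ E] [CompleteSpace E] [HilbertModule B E]
  {φ : CStarWeight A B} (K : KSGNS φ E)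

local notation "⟪" x ", " y "⟫" => HilbertModule.ip (B := B) x y

/-- `π` as a `*`-homomorphism into the C*-algebra `𝓛(E)`. -/
noncomputable def piHom : A →⋆ₙₐ[ℂ] AdjOp B E where
  toFun x := AdjOp.mk (K.π x) ⟨_, K.π_star x⟩
  map_smul' c x := Subtype.ext (map_smul K.π c x)
  map_zero' := Subtype.ext (map_zero K.π)
  map_add' x y := Subtype.ext (map_add K.π x y)
  map_mul' x y := Subtype.ext (map_mul K.π x y)
  map_star' x := (star_eq_of_adjPair (K.π_star x)).symm

theorem norm_π_le (x : A) : ‖K.π x‖ ≤ ‖x‖ := NonUnitalStarAlgHom.norm_apply_le K.piHom x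

theorem π_mul_apply (x y : A) (z : E) : K.π (x * y) z = K.π x (K.π y z) := by
  rw [map_mul]; rfl

theorem ip_π_left (x : A) (y z : E) : ⟪K.π x y, z⟫ = ⟪y, K.π (star x) z⟫ := K.π_star x y z

theorem ip_π_right (x : A) (y z : E) : ⟪y, K.π x z⟫ = ⟪K.π (star x) y, z⟫ := by
  rw [ip_π_left, star_star]

theorem tendsto_π {ι : Type*} {l : Filter ι} {f : ι → A} {x : A} (h : Tendsto f l (𝓝 x)) (y : E) :
    Tendsto (fun i => K.π (f i) y) l (𝓝 (K.π x y)) := by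
  have hlip : Tendsto (fun i => ‖f i - x‖ * ‖y‖) l (𝓝 0) := by
    simpa using (tendsto_iff_norm_sub_tendsto_zero.1 h).mul_const ‖y‖
  refine tendsto_iff_norm_sub_tendsto_zero.2 (squeeze_zero (fun _ => norm_nonneg _)
    (fun i => ?_) hlip)
  have e : K.π (f i) y - K.π x y = K.π (f i - x) y := by rw [map_sub]; rfl
  rw [e]
  exact (K.π (f i - x)).le_of_opNorm_le (K.norm_π_le _) y

/-- Non-degeneracy of `π`. -/
def Nondegenerate : Prop := Dense (Submodule.span ℂ {x : E | ∃ c y, x = K.π c y} : Set E)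

/-- `‖S Λ(c) b‖² ≤ ‖b* η(c* c) b‖` for every `c ∈ 𝓝_φ`. -/
def Dominated (S : E →L[ℂ] E) (η : A →ₗ[ℂ] 𝓜(ℂ, B)) : Prop :=
  ∀ (c : φ.N) (b : B), ‖S (K.Λ c b)‖ ^ 2 ≤ ‖star b * (η (star (c : A) * c)).fst b‖

variable {K}

/-- If `f i` is bounded and `f i c → 0` for all `c`, then `(f i)* (f i) → 0` strictly, the other
side following by taking adjoints. Strictness of `η` then sends the dominating quantity to zero. -/
theorem Dominated.tendsto_zero {S : E →L[ℂ] E} {η : A →ₗ[ℂ] 𝓜(ℂ, B)} (hS : K.Dominated S η)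
    (hη : IsStrict η) {ι : Type*} {l : Filter ι} {f : ι → φ.N} {r : ℝ}
    (hr : ∀ᶠ i in l, ‖(f i : A)‖ ≤ r) (h : ∀ c : A, Tendsto (fun i => (f i : A) * c) l (𝓝 0))
    (b : B) : Tendsto (fun i => S (K.Λ (f i) b)) l (𝓝 0) := by
  have h1 : Tendsto (fun i => (η (star (f i : A) * f i)).fst b) l (𝓝 ((η 0).fst b)) := by
    refine hη.tendsto (r := r * r) (hr.mono fun i hi => ?_) (fun c => ⟨?_, ?_⟩) b
    · rw [CStarRing.norm_star_mul_self]
      exact mul_self_le_mul_self (norm_nonneg _) hi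
    · have h2 : Tendsto (fun i => r * ‖(f i : A) * c‖) l (𝓝 0) := by
        simpa using (h c).norm.const_mul r
      rw [zero_mul]
      refine squeeze_zero_norm' (hr.mono fun i hi => ?_) h2
      rw [mul_assoc]
      exact (norm_mul_le _ _).trans (by rw [norm_star]; gcongr)
    · have h2 : Tendsto (fun i => ‖(f i : A) * star c‖ * r) l (𝓝 0) := by
        simpa using (h (star c)).norm.mul_const r
      rw [mul_zero]
      refine squeeze_zero_norm' (hr.mono fun i hi => ?_) h2
      have e : c * (star (f i : A) * f i) = star ((f i : A) * star c) * f i := by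
        rw [star_mul, star_star, mul_assoc]
      rw [e]
      exact (norm_mul_le _ _).trans (by rw [norm_star]; gcongr)
  have h3 : Tendsto (fun i => ‖star b * (η (star (f i : A) * f i)).fst b‖) l (𝓝 0) := by
    simpa using (h1.const_mul (star b)).norm
  have h4 : Tendsto (fun i => ‖S (K.Λ (f i) b)‖ ^ 2) l (𝓝 0) :=
    squeeze_zero (fun _ => by positivity) (fun i => hS (f i) b) h3
  have h5 := (Real.continuous_sqrt.tendsto 0).comp h4
  rw [Real.sqrt_zero] at h5
  refine tendsto_zero_iff_norm_tendsto_zero.2 (h5.congr fun i => ?_)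
  exact Real.sqrt_sq (norm_nonneg _)

theorem Dominated.tendsto {S : E →L[ℂ] E} {η : A →ₗ[ℂ] 𝓜(ℂ, B)} (hS : K.Dominated S η)
    (hη : IsStrict η) {ι : Type*} {l : Filter ι} {f : ι → φ.N} {a : φ.N} {r : ℝ}
    (hr : ∀ᶠ i in l, ‖(f i : A)‖ ≤ r)
    (h : ∀ c : A, Tendsto (fun i => (f i : A) * c) l (𝓝 (a * c)))
    (b : B) : Tendsto (fun i => S (K.Λ (f i) b)) l (𝓝 (S (K.Λ a b))) := by
  have h1 := hS.tendsto_zero hη (l := l) (f := fun i => f i - a) (r := r + ‖(a : A)‖)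
    (hr.mono fun i hi => (norm_sub_le _ _).trans (by gcongr)) (fun c => ?_) b
  · refine tendsto_sub_nhds_zero_iff.1 (h1.congr fun i => ?_)
    rw [map_sub]
    simp
  · simpa [sub_mul] using tendsto_sub_nhds_zero_iff.2 (h c)

variable (K) in
theorem InCommutant.of_Λ {S : E →L[ℂ] E} (h : ∀ (x : A) (a : φ.N) (b : B),
    S (K.π x (K.Λ a b)) = K.π x (S (K.Λ a b))) : K.InCommutant S := by
  intro x
  refine ContinuousLinearMap.ext_on K.dense_range ?_
  rintro _ ⟨a, b, rfl⟩
  exact h x a b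

/-- Along an approximate unit, `S Λ(a) b` is the limit of `S Λ(e a) b = π(e) S Λ(a) b`. -/
theorem mem_closure_of_dominated {S : E →L[ℂ] E} {η : A →ₗ[ℂ] 𝓜(ℂ, B)} (hS : K.Dominated S η)
    (hη : IsStrict η) (hc : K.InCommutant S) (x : E) :
    S x ∈ (Submodule.span ℂ {x : E | ∃ c y, x = K.π c y}).topologicalClosure := by
  set W := (Submodule.span ℂ {x : E | ∃ c y, x = K.π c y}).topologicalClosure
  have hW : IsClosed (W : Set E) := Submodule.isClosed_topologicalClosure _
  have h1 : ∀ x ∈ Submodule.span ℂ {x : E | ∃ a b, x = K.Λ a b}, S x ∈ W := by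
    intro x hx
    change x ∈ W.comap S.toLinearMap
    revert x
    rw [← SetLike.le_def, Submodule.span_le]
    rintro _ ⟨a, b, rfl⟩
    have hau := CStarAlgebra.increasingApproximateUnit A
    have := hau.neBot
    refine hW.mem_of_tendsto (hS.tendsto hη (l := CStarAlgebra.approximateUnit A)
      (f := fun e => φ.cone.lmul e a) (r := ‖(a : A)‖) ?_ (fun c => ?_) b)
      (Eventually.of_forall fun e => ?_)
    · filter_upwards [hau.eventually_norm] with e he
      exact (norm_mul_le _ _).trans (mul_le_of_le_one_left (norm_nonneg _) he)
    · simpa [HereditaryCone.lmul, mul_assoc] using hau.tendsto_mul_right ((a : A) * c)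
    · rw [← K.π_Λ]
      have := congrArg (fun T : E →L[ℂ] E => T (K.Λ a b)) (hc e)
      simp only [ContinuousLinearMap.comp_apply] at this
      rw [this]
      exact Submodule.le_topologicalClosure _ (Submodule.subset_span ⟨_, _, rfl⟩)
  exact (K.dense_range).induction (P := fun x => S x ∈ W) h1 (hW.preimage S.continuous) x

/-- The test vectors for implementing maps: pairing `v b` with `π(c*) y` produces `π(c) v b = S Λ(c)
b`. Since `𝓝_φ` is dense, so are its adjoints. -/
theorem dense_span_π_star (hN : φ.DenselyDefined) (hK : K.Nondegenerate) :
    Dense (Submodule.span ℂ {x : E | ∃ (c : φ.N) (y : E), x = K.π (star (c : A)) y} : Set E) := by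
  set W := (Submodule.span ℂ
    {x : E | ∃ (c : φ.N) (y : E), x = K.π (star (c : A)) y}).topologicalClosure with hWdef
  have hW : IsClosed (W : Set E) := Submodule.isClosed_topologicalClosure _
  have h1 : Submodule.span ℂ {x : E | ∃ c y, x = K.π c y} ≤ W := by
    rw [Submodule.span_le]
    rintro _ ⟨c, y, rfl⟩
    obtain ⟨u, hu, hlim⟩ := mem_closure_iff_seq_limit.1 (φ.cone.dense_leftIdeal hN (star c))
    have h2 : Tendsto (fun n => star (u n)) atTop (𝓝 c) := by
      simpa using hlim.star
    exact hW.mem_of_tendsto (K.tendsto_π h2 y) (Eventually.of_forall fun n =>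
      Submodule.le_topologicalClosure _ (Submodule.subset_span ⟨⟨u n, hu n⟩, y, rfl⟩))
  have h2 := hK.mono h1
  rw [hWdef, Submodule.topologicalClosure_coe, dense_closure] at h2
  exact h2

theorem Implements.apply {S : E →L[ℂ] E} {v : B →L[ℂ] E} (h : K.Implements S v) (c : φ.N) (b : B) :
    S (K.Λ c b) = K.π c (v b) := congrArg (fun T : B →L[ℂ] E => T b) (h.2 c)

theorem Implements.unique (hN : φ.DenselyDefined) (hK : K.Nondegenerate) {S : E →L[ℂ] E}
    {v v' : B →L[ℂ] E} (h : K.Implements S v) (h' : K.Implements S v') : v = v' := by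
  ext b
  refine eq_of_dense_ip (B := B) (dense_span_π_star hN hK) ?_
  rintro _ ⟨c, y, rfl⟩
  rw [ip_π_right, ip_π_right, star_star, ← h.apply, ← h'.apply]

/-- The map is `v b = lim S Λ(n) b` along the approximate unit of `𝓝_φ`. The relation `S Λ(c n) b =
π(c) S Λ(n) b` then gives `S Λ(c) b = π(c) v b`. -/
theorem exists_implements (hN : φ.DenselyDefined) (hK : K.Nondegenerate) {S : E →L[ℂ] E}
    {η : A →ₗ[ℂ] 𝓜(ℂ, B)} (hS : K.Dominated S η) (hη : IsStrict η) (hc : K.InCommutant S)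
    (hadj : IsAdjointable B S) : ∃ v, K.Implements S v := by
  have hne := φ.cone.approxUnit_neBot hN
  -- Domination bounds `S Λ(n) b` for each fixed `b` only; the uniform boundedness principle makes
  -- the bound uniform.
  have hbdd : ∃ C, ∀ n : {n : φ.N // ‖(n : A)‖ ≤ 2}, ‖S ∘L K.Λ n‖ ≤ C := by
    refine banach_steinhaus fun b => ?_
    obtain ⟨C, hC0, hC⟩ := hη.exists_bound b
    refine ⟨Real.sqrt (‖b‖ * (C * (2 * 2))), fun n => Real.le_sqrt_of_sq_le ?_⟩
    refine (hS n b).trans ((norm_mul_le _ _).trans ?_)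
    rw [norm_star]
    gcongr
    refine (hC _).trans ?_
    rw [CStarRing.norm_star_mul_self]
    gcongr <;> exact n.2
  obtain ⟨C, hC⟩ := hbdd
  obtain ⟨v, -, hv⟩ := exists_pointwise_limit (l := φ.cone.approxUnit)
    (fun n => S ∘L K.Λ n) (C := C) (φ.cone.approxUnit_norm.mono fun n hn => hC ⟨n, hn⟩)
    (s := Set.univ) (by simp) (fun b _ => by
      rw [cauchy_map_iff']
      rw [tendsto_uniformity_iff_dist_tendsto_zero]
      have h1 := hS.tendsto_zero hη (l := φ.cone.approxUnit ×ˢ φ.cone.approxUnit)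
        (f := fun p => p.1 - p.2) (r := 2 + 2)
        ((φ.cone.approxUnit_norm.prod_mk φ.cone.approxUnit_norm).mono fun p hp =>
          (norm_sub_le _ _).trans (add_le_add hp.1 hp.2)) (fun c => by
            simpa [sub_mul, Function.comp_def] using
              ((φ.cone.approxUnit_mul_right c).comp tendsto_fst).sub
                ((φ.cone.approxUnit_mul_right c).comp tendsto_snd)) b
      refine (tendsto_zero_iff_norm_tendsto_zero.1 h1).congr fun p => ?_
      rw [dist_eq_norm, map_sub]
      simp)
  have hπ : ∀ (c : φ.N) (b : B), S (K.Λ c b) = K.π c (v b) := by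
    intro c b
    refine tendsto_nhds_unique (hS.tendsto hη (l := φ.cone.approxUnit)
      (f := fun n => φ.cone.lmul c n) (a := c) (r := ‖(c : A)‖ * 2) ?_ (fun d => ?_) b) ?_
    · filter_upwards [φ.cone.approxUnit_norm] with n hn
      exact (norm_mul_le _ _).trans (by gcongr)
    · simpa [HereditaryCone.lmul, mul_assoc] using (φ.cone.approxUnit_mul_right d).const_mul (c : A)
    · refine (((K.π c).continuous.tendsto _).comp (hv b)).congr fun n => ?_
      rw [← K.π_Λ]
      exact (congrArg (fun T : E →L[ℂ] E => T (K.Λ n b)) (hc c)).symm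
  refine ⟨v, isAdjointable_of_dense v (dense_span_π_star hN hK) ?_,
    fun c => ContinuousLinearMap.ext (hπ c)⟩
  rintro _ ⟨c, y, rfl⟩
  obtain ⟨S', hS'⟩ := hadj
  obtain ⟨L, hL⟩ := K.adjointable c
  -- On the total set of vectors `π(c*) y` the adjoint is `v* π(c*) y = Λ(c)* S* y`.
  exact ⟨L (S' y), fun b => by rw [ip_π_right, star_star, ← hπ, hS', hL]⟩

end KSGNS

end CValued

namespace CValued

namespace KSGNS

variable {A B E : Type*} [NonUnitalCStarAlgebra A] [PartialOrder A] [StarOrderedRing A]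
  [NonUnitalCStarAlgebra B] [PartialOrder B] [StarOrderedRing B]
  [NormedAddCommGroup E] [NormedSpace ℂ E] [CompleteSpace E] [HilbertModule B E]
  {φ : CStarWeight A B} {K : KSGNS φ E}

local notation "⟪" x ", " y "⟫" => HilbertModule.ip (B := B) x y

/-! ### The extension of `π` to the multiplier algebra -/

theorem ext_of_nondegenerate (hK : K.Nondegenerate) {T T' : E →L[ℂ] E}
    (h : ∀ (c : A) (y : E), T (K.π c y) = T' (K.π c y)) : T = T' := by
  refine ContinuousLinearMap.ext_on hK ?_
  rintro _ ⟨c, y, rfl⟩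
  exact h c y

theorem ip_multiplier (m : 𝓜(ℂ, A)) (c d : A) (x y : E) :
    ⟪K.π (m.fst c) x, K.π d y⟫ = ⟪K.π c x, K.π ((star m).fst d) y⟫ := by
  rw [ip_π_right, ip_π_right, ← π_mul_apply, ← π_mul_apply, DoubleCentralizer.star_fst, star_star,
    m.central]

theorem adjPair_of_multiplier (hK : K.Nondegenerate) {m : 𝓜(ℂ, A)} {T T' : E →L[ℂ] E}
    (hT : ∀ (c : A) (y : E), T (K.π c y) = K.π (m.fst c) y)
    (hT' : ∀ (c : A) (y : E), T' (K.π c y) = K.π ((star m).fst c) y) : AdjPair B T T' := by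
  have h1 : ∀ (d : A) (z x : E), ⟪T x, K.π d z⟫ = ⟪x, T' (K.π d z)⟫ := by
    intro d z x
    rw [hT']
    refine hK.induction (P := fun x => ⟪T x, K.π d z⟫ = ⟪x, K.π ((star m).fst d) z⟫)
      (fun x hx => ?_) (isClosed_eq (T.continuous.ip B continuous_const)
        (continuous_id.ip B continuous_const)) x
    induction hx using Submodule.span_induction with
    | mem x hx =>
      obtain ⟨c, y, rfl⟩ := hx
      rw [hT, ip_multiplier]
    | zero => simp [ip_zero_left]
    | add x y _ _ h1 h2 => simp [HilbertModule.ip_add_left, h1, h2]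
    | smul c x _ h1 => simp [HilbertModule.ip_smul_left, h1]
  intro x y
  refine hK.induction (P := fun y => ⟪T x, y⟫ = ⟪x, T' y⟫)
    (fun y hy => ?_) (isClosed_eq (continuous_const.ip B continuous_id)
      (continuous_const.ip B T'.continuous)) y
  induction hy using Submodule.span_induction with
  | mem y hy =>
    obtain ⟨d, z, rfl⟩ := hy
    exact h1 d z x
  | zero => simp [ip_zero_right]
  | add x y _ _ h1 h2 => simp [ip_add_right, h1, h2]
  | smul c x _ h1 => simp [ip_smul_right, h1]

/-- The operators `π(m e)`, with `e` in an approximate unit, are bounded by `‖m‖` and converge on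
each `π(c) y` because `m (e c) → m c`. -/
theorem exists_multiplier_op (hK : K.Nondegenerate) (m : 𝓜(ℂ, A)) :
    ∃ T : E →L[ℂ] E, ‖T‖ ≤ ‖m‖ ∧ ∀ (c : A) (y : E), T (K.π c y) = K.π (m.fst c) y := by
  have hau := CStarAlgebra.increasingApproximateUnit A
  have := hau.neBot
  have hlim : ∀ (c : A) (y : E), Tendsto (fun e => K.π (m.fst e) (K.π c y))
      (CStarAlgebra.approximateUnit A) (𝓝 (K.π (m.fst c) y)) := by
    intro c y
    have h1 := K.tendsto_π ((m.fst.continuous.tendsto _).comp (hau.tendsto_mul_right c)) y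
    refine h1.congr fun e => ?_
    rw [Function.comp_apply, multiplier_fst_mul, π_mul_apply]
  obtain ⟨T, hT, h⟩ := exists_pointwise_limit (l := CStarAlgebra.approximateUnit A)
    (fun e => K.π (m.fst e)) (C := ‖m‖) (by
      filter_upwards [hau.eventually_norm] with e he
      refine (K.norm_π_le _).trans ((m.fst.le_opNorm e).trans ?_)
      rw [DoubleCentralizer.norm_fst]
      exact mul_le_of_le_one_right (norm_nonneg _) he) hK (by
      rintro _ ⟨c, y, rfl⟩
      exact (hlim c y).cauchy_map)
  exact ⟨T, hT, fun c y => tendsto_nhds_unique (h _) (hlim c y)⟩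

theorem πM_spec (hK : K.Nondegenerate) (m : 𝓜(ℂ, A)) :
    IsAdjointable B (K.πM m) ∧ ∀ c : A, K.πM m ∘L K.π c = K.π (m.fst c) := by
  obtain ⟨T, -, hT⟩ := K.exists_multiplier_op hK m
  obtain ⟨T', -, hT'⟩ := K.exists_multiplier_op hK (star m)
  exact Classical.epsilon_spec (p := fun T : E →L[ℂ] E =>
    IsAdjointable B T ∧ ∀ c : A, T ∘L K.π c = K.π (m.fst c))
    ⟨T, ⟨T', adjPair_of_multiplier hK hT hT'⟩, fun c => ContinuousLinearMap.ext (hT c)⟩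

theorem πM_apply (hK : K.Nondegenerate) (m : 𝓜(ℂ, A)) (c : A) (y : E) :
    K.πM m (K.π c y) = K.π (m.fst c) y :=
  congrArg (fun T : E →L[ℂ] E => T y) ((πM_spec hK m).2 c)

theorem πM_eq (hK : K.Nondegenerate) {m : 𝓜(ℂ, A)} {T : E →L[ℂ] E}
    (h : ∀ (c : A) (y : E), T (K.π c y) = K.π (m.fst c) y) : K.πM m = T :=
  ext_of_nondegenerate hK fun c y => by rw [πM_apply hK, h]

theorem norm_πM_le (hK : K.Nondegenerate) (m : 𝓜(ℂ, A)) : ‖K.πM m‖ ≤ ‖m‖ := by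
  obtain ⟨T, hT, h⟩ := K.exists_multiplier_op hK m
  rwa [πM_eq hK h]

theorem adjPair_πM (hK : K.Nondegenerate) (m : 𝓜(ℂ, A)) :
    AdjPair B (K.πM m) (K.πM (star m)) :=
  adjPair_of_multiplier hK (πM_apply hK m) (πM_apply hK (star m))

theorem πM_add (hK : K.Nondegenerate) (m n : 𝓜(ℂ, A)) : K.πM (m + n) = K.πM m + K.πM n :=
  πM_eq hK fun c y => by
    rw [add_apply, πM_apply hK, πM_apply hK, DoubleCentralizer.add_fst, add_apply, map_add]
    rfl

theorem πM_smul (hK : K.Nondegenerate) (z : ℂ) (m : 𝓜(ℂ, A)) : K.πM (z • m) = z • K.πM m :=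
  πM_eq hK fun c y => by
    rw [smul_apply, πM_apply hK, DoubleCentralizer.smul_fst, smul_apply, map_smul]
    rfl

theorem πM_mul (hK : K.Nondegenerate) (m n : 𝓜(ℂ, A)) : K.πM (m * n) = K.πM m ∘L K.πM n :=
  πM_eq hK fun c y => by
    rw [ContinuousLinearMap.comp_apply, πM_apply hK, πM_apply hK, DoubleCentralizer.mul_fst]
    rfl

theorem πM_coe (hK : K.Nondegenerate) (x : A) : K.πM (DoubleCentralizer.coe ℂ x) = K.π x :=
  πM_eq hK fun c y => by
    rw [← π_mul_apply]
    rfl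

theorem inCommutant_πM (hK : K.Nondegenerate) {S : E →L[ℂ] E} (hS : K.InCommutant S)
    (m : 𝓜(ℂ, A)) (x : E) : S (K.πM m x) = K.πM m (S x) := by
  have hS' : ∀ c y, S (K.π c y) = K.π c (S y) := fun c y =>
    congrArg (fun T : E →L[ℂ] E => T y) (hS c)
  have h : S ∘L K.πM m = K.πM m ∘L S := ext_of_nondegenerate hK fun c y => by
    simp only [ContinuousLinearMap.comp_apply]
    rw [πM_apply hK, hS', hS', πM_apply hK]
  exact congrArg (fun T : E →L[ℂ] E => T x) h

theorem tendsto_πM (hK : K.Nondegenerate) {ι : Type*} {l : Filter ι} {f : ι → 𝓜(ℂ, A)}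
    {m : 𝓜(ℂ, A)} {r : ℝ} (hr : ∀ᶠ i in l, ‖f i‖ ≤ r)
    (h : ∀ c, Tendsto (fun i => (f i).fst c) l (𝓝 (m.fst c))) (x : E) :
    Tendsto (fun i => K.πM (f i) x) l (𝓝 (K.πM m x)) := by
  refine tendsto_of_dense (hr.mono fun i hi => (norm_πM_le hK _).trans hi) hK ?_ x
  rintro _ ⟨c, y, rfl⟩
  rw [πM_apply hK]
  simp_rw [πM_apply hK]
  exact K.tendsto_π (h c) y

theorem tendsto_π_of_strict (hK : K.Nondegenerate) {ι : Type*} {l : Filter ι} {f : ι → A}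
    {m : 𝓜(ℂ, A)} {r : ℝ} (hr : ∀ᶠ i in l, ‖f i‖ ≤ r)
    (h : ∀ c, Tendsto (fun i => f i * c) l (𝓝 (m.fst c))) (x : E) :
    Tendsto (fun i => K.π (f i) x) l (𝓝 (K.πM m x)) := by
  refine tendsto_of_dense (hr.mono fun i hi => (norm_π_le _ _).trans hi) hK ?_ x
  rintro _ ⟨c, y, rfl⟩
  rw [πM_apply hK]
  simp_rw [← π_mul_apply]
  exact K.tendsto_π (h c) y

end KSGNS

/-! ### Compressions of `π` -/

theorem norm_coe_multiplier {A : Type*} [NonUnitalCStarAlgebra A] (x : A) :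
    ‖(DoubleCentralizer.coe ℂ x : 𝓜(ℂ, A))‖ ≤ ‖x‖ := by
  rw [← DoubleCentralizer.norm_fst, DoubleCentralizer.coe_fst]
  exact ContinuousLinearMap.opNorm_mul_apply_le ℂ A x

section Compression

variable {B : Type*} [NonUnitalCStarAlgebra B] [PartialOrder B] [StarOrderedRing B]

/-- Adjointable operators on `B` are multipliers of `B`. -/
noncomputable def multiplierOfAdjPair (T T' : B →L[ℂ] B) (h : AdjPair B T T') : 𝓜(ℂ, B) where
  fst := T
  snd := LinearMap.mkContinuous
    { toFun := fun b => star (T' (star b))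
      map_add' := fun x y => by simp
      map_smul' := fun c x => by simp [star_smul] } ‖T'‖
    (fun x => by simpa using T'.le_opNorm (star x))
  central x y := by
    have := h y (star x)
    change star (star x) * T y = star (T' (star x)) * y at this
    rw [star_star] at this
    exact this.symm

theorem multiplierOfAdjPair_fst (T T' : B →L[ℂ] B) (h : AdjPair B T T') (b : B) :
    (multiplierOfAdjPair T T' h).fst b = T b := rfl

end Compression

namespace KSGNS

variable {A B E : Type*} [NonUnitalCStarAlgebra A] [PartialOrder A] [StarOrderedRing A]
  [NonUnitalCStarAlgebra B] [PartialOrder B] [StarOrderedRing B]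
  [NormedAddCommGroup E] [NormedSpace ℂ E] [CompleteSpace E] [HilbertModule B E]
  {φ : CStarWeight A B} {K : KSGNS φ E}

local notation "⟪" x ", " y "⟫" => HilbertModule.ip (B := B) x y

/-- The map `m ↦ v* π(m) v` from `M(A)` into `M(B)`. -/
noncomputable def compression (hK : K.Nondegenerate) {v : B →L[ℂ] E} {v' : E →L[ℂ] B}
    (h : AdjPair B v v') : 𝓜(ℂ, A) →ₗ[ℂ] 𝓜(ℂ, B) where
  toFun m := multiplierOfAdjPair (v' ∘L (K.πM m ∘L v)) ((v' ∘L K.πM (star m)) ∘L v)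
    (h.symm.comp ((adjPair_πM hK m).comp h))
  map_add' m n := multiplier_fst_ext fun b => by
    rw [DoubleCentralizer.add_fst, add_apply]
    simp only [multiplierOfAdjPair_fst, πM_add hK]
    simp
  map_smul' z m := multiplier_fst_ext fun b => by
    rw [DoubleCentralizer.smul_fst, smul_apply]
    simp only [multiplierOfAdjPair_fst, πM_smul hK]
    simp

variable {v : B →L[ℂ] E} {v' : E →L[ℂ] B}

theorem compression_fst (hK : K.Nondegenerate) (h : AdjPair B v v') (m : 𝓜(ℂ, A)) (b : B) :
    (compression hK h m).fst b = v' (K.πM m (v b)) := rfl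

theorem compression_snd (hK : K.Nondegenerate) (h : AdjPair B v v') (m : 𝓜(ℂ, A)) (b : B) :
    (compression hK h m).snd b = star (v' (K.πM (star m) (v (star b)))) := rfl

theorem star_mul_compression_fst (hK : K.Nondegenerate) (h : AdjPair B v v') (m : 𝓜(ℂ, A))
    (b c : B) : star c * (compression hK h m).fst b = ⟪K.πM m (v b), v c⟫ := by
  rw [compression_fst]
  exact h.symm (K.πM m (v b)) c

theorem compression_tendsto (hK : K.Nondegenerate) (h : AdjPair B v v') {ι : Type*} {l : Filter ι}
    {f : ι → 𝓜(ℂ, A)} {m : 𝓜(ℂ, A)} {r : ℝ} (hr : ∀ᶠ i in l, ‖f i‖ ≤ r)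
    (hf : StrictTendsto f l m) : StrictTendsto (fun i => compression hK h (f i)) l
      (compression hK h m) := by
  intro b
  constructor
  · exact (v'.continuous.tendsto _).comp (tendsto_πM hK hr (fun c => (hf c).1) (v b))
  · simp only [compression_snd]
    refine ((v'.continuous.tendsto _).comp (tendsto_πM hK (f := fun i => star (f i)) (r := r)
      (by simpa using hr) (fun c => ?_) (v (star b)))).star
    simp only [DoubleCentralizer.star_fst]
    exact (hf (star c)).2.star

/-- The restriction of `m ↦ v* π(m) v` to `A`. -/
noncomputable def compressionA (hK : K.Nondegenerate) (h : AdjPair B v v') :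
    A →ₗ[ℂ] 𝓜(ℂ, B) where
  toFun x := compression hK h (DoubleCentralizer.coe ℂ x)
  map_add' x y := by rw [← map_add]; congr 1; exact map_add (DoubleCentralizer.coeHom (𝕜 := ℂ)) x y
  map_smul' z x := by
    rw [RingHom.id_apply, ← map_smul]; congr 1
    exact map_smul (DoubleCentralizer.coeHom (𝕜 := ℂ)) z x

theorem compressionA_apply (hK : K.Nondegenerate) (h : AdjPair B v v') (x : A) :
    compressionA hK h x = compression hK h (DoubleCentralizer.coe ℂ x) := rfl

theorem star_mul_compressionA_fst (hK : K.Nondegenerate) (h : AdjPair B v v') (x : A)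
    (b c : B) : star c * (compressionA hK h x).fst b = ⟪K.π x (v b), v c⟫ := by
  rw [compressionA_apply, star_mul_compression_fst, πM_coe hK]

theorem isStrict_compressionA (hK : K.Nondegenerate) (h : AdjPair B v v') :
    IsStrict (compressionA hK h) := fun _ _ _ hr hf =>
  compression_tendsto hK h (hr.mono fun x hx => (norm_coe_multiplier x).trans hx) hf

theorem isCP_compressionA (hK : K.Nondegenerate) (h : AdjPair B v v') :
    IsCP (compressionA hK h) := by
  intro n a b
  have e : ∑ i, ∑ j, star (b j) * (compressionA hK h (star (a j) * a i)).fst (b i) =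
      ⟪∑ i, K.π (a i) (v (b i)), ∑ i, K.π (a i) (v (b i))⟫ := by
    rw [ip_sum_left]
    refine Finset.sum_congr rfl fun i _ => ?_
    rw [ip_sum_right]
    refine Finset.sum_congr rfl fun j _ => ?_
    rw [star_mul_compressionA_fst, π_mul_apply, ip_π_left, star_star]
  rw [e]
  exact HilbertModule.ip_self_nonneg _

/-- The strict extension of `x ↦ v* π(x) v` to `M(A)` is `m ↦ v* π(m) v`. -/
theorem strictExtension_compressionA (hK : K.Nondegenerate) (h : AdjPair B v v') :
    strictExtension (compressionA hK h) = compression hK h := by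
  have hex : IsStrictExtension (compressionA hK h) (compression hK h) :=
    ⟨fun _ => rfl, fun _ _ _ hr hf => compression_tendsto hK h hr hf⟩
  have hspec : IsStrictExtension (compressionA hK h) (strictExtension (compressionA hK h)) :=
    Classical.epsilon_spec ⟨_, hex⟩
  have hau := CStarAlgebra.increasingApproximateUnit A
  have := hau.neBot
  refine LinearMap.ext fun m => multiplier_fst_ext fun b => ?_
  -- The bounded net `m e` in `A` converges strictly to `m`, so any two strict extensions agree at
  -- `m`.
  set f : A → 𝓜(ℂ, A) := fun e => DoubleCentralizer.coe ℂ (m.fst e)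
  have hr : ∀ᶠ e in CStarAlgebra.approximateUnit A, ‖f e‖ ≤ ‖m‖ := by
    filter_upwards [hau.eventually_norm] with e he
    refine (norm_coe_multiplier _).trans ((m.fst.le_opNorm e).trans ?_)
    rw [DoubleCentralizer.norm_fst]
    exact mul_le_of_le_one_right (norm_nonneg _) he
  have hf : StrictTendsto f (CStarAlgebra.approximateUnit A) m := by
    intro c
    constructor
    · refine ((m.fst.continuous.tendsto _).comp (hau.tendsto_mul_right c)).congr fun e => ?_
      exact multiplier_fst_mul m e c
    · refine (hau.tendsto_mul_left (m.snd c)).congr fun e => ?_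
      exact m.central c e
  have hf' : ∀ σ, IsStrictExtension (compressionA hK h) σ →
      Tendsto (fun e => (compressionA hK h (m.fst e)).fst b) (CStarAlgebra.approximateUnit A)
        (𝓝 ((σ m).fst b)) := by
    intro σ hσ
    have h1 := (hσ.2 ‖m‖ (map f (CStarAlgebra.approximateUnit A)) m hr
      (fun c => ⟨tendsto_map'_iff.2 (hf c).1, tendsto_map'_iff.2 (hf c).2⟩) b).1
    refine (tendsto_map'_iff.1 h1).congr fun e => ?_
    rw [Function.comp_apply, hσ.1]
  exact tendsto_nhds_unique (hf' _ hspec) (hf' _ hex)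

end KSGNS

end CValued

namespace CValued

/-! ### Algebra and order of strict completely positive maps -/

section StrictMaps

variable {A B : Type*} [NonUnitalCStarAlgebra A] [NonUnitalCStarAlgebra B]

theorem StrictTendsto.add {ι : Type*} {l : Filter ι} {f g : ι → 𝓜(ℂ, B)} {m n : 𝓜(ℂ, B)}
    (hf : StrictTendsto f l m) (hg : StrictTendsto g l n) :
    StrictTendsto (fun i => f i + g i) l (m + n) := fun b =>
  ⟨(hf b).1.add (hg b).1, (hf b).2.add (hg b).2⟩

theorem StrictTendsto.const_smul {ι : Type*} {l : Filter ι} {f : ι → 𝓜(ℂ, B)} {m : 𝓜(ℂ, B)}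
    (hf : StrictTendsto f l m) (z : ℂ) : StrictTendsto (fun i => z • f i) l (z • m) := fun b =>
  ⟨(hf b).1.const_smul z, (hf b).2.const_smul z⟩

theorem IsStrict.add {ρ η : A →ₗ[ℂ] 𝓜(ℂ, B)} (hρ : IsStrict ρ) (hη : IsStrict η) :
    IsStrict (ρ + η) := fun r l x hr h => (hρ r l x hr h).add (hη r l x hr h)

theorem IsStrict.smul {ρ : A →ₗ[ℂ] 𝓜(ℂ, B)} (hρ : IsStrict ρ) (z : ℂ) :
    IsStrict (z • ρ) := fun r l x hr h => (hρ r l x hr h).const_smul z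

theorem IsStrict.sub {ρ η : A →ₗ[ℂ] 𝓜(ℂ, B)} (hρ : IsStrict ρ) (hη : IsStrict η) :
    IsStrict (ρ - η) := by
  have e : ρ - η = ρ + (-1 : ℂ) • η := LinearMap.ext fun x => by simp [sub_eq_add_neg]
  exact e ▸ hρ.add (hη.smul (-1))

/-- Strict maps are determined by their values on a set with dense span. -/
theorem IsStrict.ext {ρ η : A →ₗ[ℂ] 𝓜(ℂ, B)} (hρ : IsStrict ρ) (hη : IsStrict η) {s : Set A}
    (hs : Dense (Submodule.span ℂ s : Set A))
    (h : ∀ x ∈ s, ∀ b c : B, star c * (ρ x).fst b = star c * (η x).fst b) : ρ = η := by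
  refine LinearMap.ext fun x => multiplier_fst_ext fun b => ?_
  have heq : Set.EqOn (fun x => (ρ x).fst b) (fun x => (η x).fst b) (Submodule.span ℂ s) := by
    intro x hx
    induction hx using Submodule.span_induction with
    | mem x hx =>
      refine eq_of_mul_left_eq fun z => ?_
      have := h x hx b (star z)
      rwa [star_star] at this
    | zero => simp
    | add x y _ _ hx hy => simp only [map_add, DoubleCentralizer.add_fst, add_apply, hx, hy]
    | smul c x _ hx => simp only [map_smul, DoubleCentralizer.smul_fst, smul_apply, hx]
  exact congrFun (Continuous.ext_on hs (hρ.continuous b) (hη.continuous b) heq) x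

variable [PartialOrder B]

theorem cpLe_refl (ρ : A →ₗ[ℂ] 𝓜(ℂ, B)) : CPLe ρ ρ := by
  intro n a b
  simp

variable [StarOrderedRing B]

theorem IsCP.add {ρ η : A →ₗ[ℂ] 𝓜(ℂ, B)} (hρ : IsCP ρ) (hη : IsCP η) : IsCP (ρ + η) := by
  intro n a b
  refine (add_nonneg (hρ n a b) (hη n a b)).trans_eq ?_
  simp only [← Finset.sum_add_distrib]
  refine Finset.sum_congr rfl fun i _ => Finset.sum_congr rfl fun j _ => ?_
  rw [← mul_add]
  rfl

theorem IsCP.smul {ρ : A →ₗ[ℂ] 𝓜(ℂ, B)} (hρ : IsCP ρ) {t : ℝ} (ht : 0 ≤ t) :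
    IsCP ((t : ℂ) • ρ) := by
  intro n a b
  refine (smul_nonneg ht (hρ n a b)).trans_eq ?_
  simp only [Finset.smul_sum]
  refine Finset.sum_congr rfl fun i _ => Finset.sum_congr rfl fun j _ => ?_
  rw [← Complex.coe_smul, ← mul_smul_comm]
  rfl

theorem cpLe_trans {ρ η ξ : A →ₗ[ℂ] 𝓜(ℂ, B)} (h : CPLe ρ η) (h' : CPLe η ξ) : CPLe ρ ξ := by
  have := IsCP.add h h'
  rwa [sub_add_sub_cancel'] at this

end StrictMaps

namespace KSGNS

variable {A B E : Type*} [NonUnitalCStarAlgebra A] [PartialOrder A] [StarOrderedRing A]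
  [NonUnitalCStarAlgebra B] [PartialOrder B] [StarOrderedRing B]
  [NormedAddCommGroup E] [NormedSpace ℂ E] [CompleteSpace E] [HilbertModule B E]
  {φ : CStarWeight A B} {K : KSGNS φ E}

local notation "⟪" x ", " y "⟫" => HilbertModule.ip (B := B) x y

/-! ### The operators `T_ρ` -/

theorem ext_of_Λ {T T' : AdjOp B E} (h : ∀ (a₁ a₂ : φ.N) (b₁ b₂ : B),
    ⟪T.1 (K.Λ a₁ b₁), K.Λ a₂ b₂⟫ = ⟪T'.1 (K.Λ a₁ b₁), K.Λ a₂ b₂⟫) : T = T' := by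
  refine Subtype.ext (ContinuousLinearMap.ext_on K.dense_range ?_)
  rintro _ ⟨a₁, b₁, rfl⟩
  refine eq_of_dense_ip (B := B) K.dense_range ?_
  rintro _ ⟨a₂, b₂, rfl⟩
  exact h a₁ a₂ b₁ b₂

variable (K) in
/-- The positive element `T_ρ` of the C*-algebra `𝓛(E)`. -/
noncomputable def opT (ρ : A →ₗ[ℂ] 𝓜(ℂ, B)) : AdjOp B E :=
  Classical.epsilon fun T : AdjOp B E => K.Represents T.1 ρ

theorem represents_opT {ρ : A →ₗ[ℂ] 𝓜(ℂ, B)} (hρ : ρ ∈ K.H) : K.Represents (K.opT ρ).1 ρ := by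
  obtain ⟨-, -, T, hT⟩ := hρ
  obtain ⟨S, S', hS, hTS⟩ := id hT.1
  exact Classical.epsilon_spec (p := fun T : AdjOp B E => K.Represents T.1 ρ)
    ⟨AdjOp.mk T ⟨_, hTS ▸ hS.symm.comp hS⟩, hT⟩

theorem opT_nonneg {ρ : A →ₗ[ℂ] 𝓜(ℂ, B)} (hρ : ρ ∈ K.H) : 0 ≤ K.opT ρ :=
  isPositiveOp_iff.1 (represents_opT hρ).1

theorem ip_opT {ρ : A →ₗ[ℂ] 𝓜(ℂ, B)} (hρ : ρ ∈ K.H) (a₁ a₂ : φ.N) (b₁ b₂ : B) :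
    ⟪(K.opT ρ).1 (K.Λ a₁ b₁), K.Λ a₂ b₂⟫ = star b₂ * (ρ (star (a₂ : A) * (a₁ : A))).fst b₁ :=
  (represents_opT hρ).2 a₁ a₂ b₁ b₂

theorem opT_eq {ρ : A →ₗ[ℂ] 𝓜(ℂ, B)} (hρ : ρ ∈ K.H) {T : AdjOp B E}
    (h : ∀ (a₁ a₂ : φ.N) (b₁ b₂ : B), ⟪T.1 (K.Λ a₁ b₁), K.Λ a₂ b₂⟫ =
      star b₂ * (ρ (star (a₂ : A) * (a₁ : A))).fst b₁) : K.opT ρ = T :=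
  ext_of_Λ (K := K) fun a₁ a₂ b₁ b₂ => by rw [ip_opT hρ, h]

theorem T_eq {ρ : A →ₗ[ℂ] 𝓜(ℂ, B)} (hρ : ρ ∈ K.H) : K.T ρ = (K.opT ρ).1 := by
  have hspec : K.Represents (K.T ρ) ρ :=
    Classical.epsilon_spec (p := fun T => K.Represents T ρ) ⟨_, represents_opT hρ⟩
  obtain ⟨S, S', hS, hTS⟩ := id hspec.1
  exact congrArg Subtype.val (opT_eq (T := AdjOp.mk (K.T ρ) ⟨_, hTS ▸ hS.symm.comp hS⟩) hρ
    hspec.2).symm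

theorem mem_H {ρ : A →ₗ[ℂ] 𝓜(ℂ, B)} (h1 : IsStrict ρ) (h2 : IsCP ρ) {T : AdjOp B E} (hT : 0 ≤ T)
    (h : ∀ (a₁ a₂ : φ.N) (b₁ b₂ : B), ⟪T.1 (K.Λ a₁ b₁), K.Λ a₂ b₂⟫ =
      star b₂ * (ρ (star (a₂ : A) * (a₁ : A))).fst b₁) : ρ ∈ K.H ∧ K.opT ρ = T := by
  have hρ : ρ ∈ K.H := ⟨h1, h2, T.1, isPositiveOp_iff.2 hT, h⟩
  exact ⟨hρ, opT_eq hρ h⟩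

theorem add_mem_H {ρ η : A →ₗ[ℂ] 𝓜(ℂ, B)} (hρ : ρ ∈ K.H) (hη : η ∈ K.H) :
    ρ + η ∈ K.H ∧ K.opT (ρ + η) = K.opT ρ + K.opT η :=
  mem_H (hρ.1.add hη.1) (hρ.2.1.add hη.2.1) (add_nonneg (opT_nonneg hρ) (opT_nonneg hη))
    fun a₁ a₂ b₁ b₂ => by
      rw [AdjOp.add_apply, HilbertModule.ip_add_left, ip_opT hρ, ip_opT hη, ← mul_add]
      rfl

theorem smul_mem_H {ρ : A →ₗ[ℂ] 𝓜(ℂ, B)} (hρ : ρ ∈ K.H) {t : ℝ} (ht : 0 ≤ t) :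
    (t : ℂ) • ρ ∈ K.H ∧ K.opT ((t : ℂ) • ρ) = t • K.opT ρ :=
  mem_H (hρ.1.smul t) (hρ.2.1.smul ht) (smul_nonneg ht (opT_nonneg hρ))
    fun a₁ a₂ b₁ b₂ => by
      rw [← Complex.coe_smul, AdjOp.smul_apply, HilbertModule.ip_smul_left, ip_opT hρ,
        ← mul_smul_comm]
      rfl

theorem zero_mem_H : (0 : A →ₗ[ℂ] 𝓜(ℂ, B)) ∈ K.H ∧ K.opT (0 : A →ₗ[ℂ] 𝓜(ℂ, B)) = 0 := by
  refine mem_H (fun _ _ _ _ _ b => ?_) (fun _ _ _ => ?_) le_rfl fun _ _ _ _ => ?_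
  · exact ⟨tendsto_const_nhds, tendsto_const_nhds⟩
  · simp
  · rw [AdjOp.zero_apply, ip_zero_left]
    simp

theorem inCommutant_iff {S : AdjOp B E} : K.InCommutant S.1 ↔ ∀ x, Commute S (K.piHom x) :=
  ⟨fun h x => Subtype.ext (h x), fun h x => congrArg Subtype.val (h x)⟩

/-- Against `Λ(a₂) b₂`, both `T_ρ π(x) Λ(a) b` and `π(x) T_ρ Λ(a) b` give `b₂* ρ(a₂* x a) b`. -/
theorem commute_opT {ρ : A →ₗ[ℂ] 𝓜(ℂ, B)} (hρ : ρ ∈ K.H) (x : A) :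
    Commute (K.opT ρ) (K.piHom x) := by
  refine inCommutant_iff.1 (InCommutant.of_Λ K fun x a b => ?_) x
  refine eq_of_dense_ip (B := B) K.dense_range ?_
  rintro _ ⟨a₂, b₂, rfl⟩
  rw [ip_π_left, K.π_Λ, K.π_Λ, ip_opT hρ, ip_opT hρ]
  simp [HereditaryCone.lmul, mul_assoc]

theorem dominated_of_le {S : AdjOp B E} {η : A →ₗ[ℂ] 𝓜(ℂ, B)} (hη : η ∈ K.H)
    (h : star S * S ≤ K.opT η) : K.Dominated S.1 η := by
  intro c b
  rw [norm_sq_apply, ← ip_opT hη]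
  exact norm_ip_mono (star_mul_self_nonneg S) h _

theorem exists_implements_of_le (hN : φ.DenselyDefined) (hK : K.Nondegenerate) {S : AdjOp B E}
    {η : A →ₗ[ℂ] 𝓜(ℂ, B)} (hη : η ∈ K.H) (h : star S * S ≤ K.opT η) (hc : K.InCommutant S.1) :
    ∃ v, K.Implements S.1 v :=
  exists_implements hN hK (dominated_of_le hη h) hη.1 hc S.2

theorem ip_implements {S : AdjOp B E} {v : B →L[ℂ] E} (h : K.Implements S.1 v) (a₁ a₂ : φ.N)
    (b₁ b₂ : B) : ⟪(star S * S).1 (K.Λ a₁ b₁), K.Λ a₂ b₂⟫ =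
      ⟪K.π (star (a₂ : A) * a₁) (v b₁), v b₂⟫ := by
  rw [AdjOp.mul_apply, ip_apply_left, star_star, h.apply, h.apply, ip_π_right, ← π_mul_apply]

/-- A Radon–Nikodym principle: `T^{1/2}` is dominated by `η`, hence implemented by some `v`, and `ρ
= v* π(·) v` is the required map. -/
theorem exists_mem_H_of_le (hN : φ.DenselyDefined) (hK : K.Nondegenerate) {T : AdjOp B E}
    (hT : 0 ≤ T) (hc : ∀ x, Commute T (K.piHom x)) {η : A →ₗ[ℂ] 𝓜(ℂ, B)} (hη : η ∈ K.H)
    (h : T ≤ K.opT η) : ∃ ρ ∈ K.H, K.opT ρ = T := by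
  have hsq : star (CFC.sqrt T) * CFC.sqrt T = T := by
    rw [(IsSelfAdjoint.of_nonneg (CFC.sqrt_nonneg T)).star_eq, CFC.sqrt_mul_sqrt_self T hT]
  obtain ⟨v, hv⟩ := exists_implements_of_le hN hK (S := CFC.sqrt T) hη (hsq.trans_le h)
    (inCommutant_iff.2 fun x => commute_sqrt (hc x))
  obtain ⟨v', hvv⟩ := hv.1
  refine ⟨compressionA hK hvv, mem_H (isStrict_compressionA hK hvv) (isCP_compressionA hK hvv) hT
    fun a₁ a₂ b₁ b₂ => ?_⟩
  rw [star_mul_compressionA_fst, ← ip_implements hv, hsq]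

/-- Both strict maps agree on the products `a₂* a₁`, which span a dense subspace. The strict
extension of `ρ` thereby becomes computable as `v* π(·) v`. -/
theorem eq_compressionA (hN : φ.DenselyDefined) (hK : K.Nondegenerate) {S : AdjOp B E}
    {v : B →L[ℂ] E} {v' : E →L[ℂ] B} (hv : K.Implements S.1 v) (hvv : AdjPair B v v')
    {ρ : A →ₗ[ℂ] 𝓜(ℂ, B)} (hρ : ρ ∈ K.H) (hS : star S * S = K.opT ρ) :
    ρ = compressionA hK hvv := by
  refine hρ.1.ext (isStrict_compressionA hK hvv) (φ.cone.dense_span_star_mul hN) ?_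
  rintro _ ⟨a₁, a₂, rfl⟩ b c
  rw [star_mul_compressionA_fst, ← ip_implements hv, hS, ip_opT hρ]

/-- Complete positivity of `η - ρ` is exactly positivity of the form of `T_η - T_ρ` on finite sums
of vectors `Λ(a) b`. -/
theorem opT_mono (ρ η : A →ₗ[ℂ] 𝓜(ℂ, B)) (hρ : ρ ∈ K.H) (hη : η ∈ K.H) (h : CPLe ρ η) :
    K.opT ρ ≤ K.opT η := by
  rw [← sub_nonneg, nonneg_iff_forall_ip]
  have h1 : ∀ x ∈ Submodule.span ℂ {x : E | ∃ a b, x = K.Λ a b},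
      0 ≤ ⟪(K.opT η - K.opT ρ).1 x, x⟫ := by
    intro x hx
    obtain ⟨n, f, g, rfl⟩ := Submodule.mem_span_set'.1 hx
    choose a b hab using fun i => (g i).2
    have e : ∑ i, f i • (g i : E) = ∑ i, K.Λ (a i) (f i • b i) :=
      Finset.sum_congr rfl fun i _ => by rw [hab, map_smul]
    rw [e]
    refine (h n (fun i => a i) (fun i => f i • b i)).trans_eq ?_
    rw [map_sum, ip_sum_left]
    refine Finset.sum_congr rfl fun i _ => ?_
    rw [ip_sum_right]
    refine Finset.sum_congr rfl fun j _ => ?_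
    rw [AdjOp.sub_apply, ip_sub_left, ip_opT hη, ip_opT hρ, ← mul_sub]
    rfl
  intro x
  exact K.dense_range.induction (P := fun x => 0 ≤ ⟪(K.opT η - K.opT ρ).1 x, x⟫) h1
    (isClosed_le continuous_const
      (((K.opT η - K.opT ρ).1.continuous).ip B continuous_id)) x

/-- The operator `T_η - T_ρ` lies below `T_η` and commutes with `π(A)`, so it represents a
completely positive map, which must be `η - ρ`. -/
theorem cpLe_of_opT_le (hN : φ.DenselyDefined) (hK : K.Nondegenerate) {ρ η : A →ₗ[ℂ] 𝓜(ℂ, B)}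
    (hρ : ρ ∈ K.H) (hη : η ∈ K.H) (h : K.opT ρ ≤ K.opT η) : CPLe ρ η := by
  obtain ⟨ξ, hξ, hT⟩ := exists_mem_H_of_le hN hK (sub_nonneg.2 h)
    (fun x => (commute_opT hη x).sub_left (commute_opT hρ x)) hη (sub_le_self _ (opT_nonneg hρ))
  have e : η - ρ = ξ := by
    refine (hη.1.sub hρ.1).ext hξ.1 (φ.cone.dense_span_star_mul hN) ?_
    rintro _ ⟨a₁, a₂, rfl⟩ b c
    rw [← ip_opT hξ, hT, AdjOp.sub_apply, ip_sub_left, ip_opT hη, ip_opT hρ, ← mul_sub]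
    rfl
  rw [CPLe, e]
  exact hξ.2.1

/-! ### The directed set `𝓖_φ` -/

theorem mem_F_iff {ρ : A →ₗ[ℂ] 𝓜(ℂ, B)} : ρ ∈ K.F ↔ ρ ∈ K.H ∧ K.opT ρ ≤ 1 := by
  refine and_congr_right fun hρ => ?_
  rw [T_eq hρ, ← sub_nonneg, ← isPositiveOp_iff]
  rfl

theorem mem_G_iff {ρ : A →ₗ[ℂ] 𝓜(ℂ, B)} : ρ ∈ K.G ↔
    ρ ∈ K.H ∧ ∃ t : ℝ, 0 ≤ t ∧ t < 1 ∧ K.opT ρ ≤ algebraMap ℝ _ t := by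
  constructor
  · rintro ⟨t, ht0, ht1, η, hη, rfl⟩
    rw [mem_F_iff] at hη
    refine ⟨(smul_mem_H hη.1 ht0).1, t, ht0, ht1, ?_⟩
    rw [(smul_mem_H hη.1 ht0).2, Algebra.algebraMap_eq_smul_one]
    exact smul_le_smul_of_nonneg_left hη.2 ht0
  · rintro ⟨hρ, t, ht0, ht1, h⟩
    -- The bound `t` may be zero; enlarging it permits the factorization `ρ = s (s⁻¹ ρ)`.
    set s := max t (1 / 2)
    have hs0 : 0 < s := lt_of_lt_of_le (by norm_num) (le_max_right _ _)
    have hs1 : s < 1 := max_lt ht1 (by norm_num)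
    refine ⟨s, hs0.le, hs1, ((s⁻¹ : ℝ) : ℂ) • ρ, mem_F_iff.2
      ⟨(smul_mem_H hρ (inv_nonneg.2 hs0.le)).1, ?_⟩, ?_⟩
    · rw [(smul_mem_H hρ (inv_nonneg.2 hs0.le)).2]
      have h2 : K.opT ρ ≤ s • (1 : AdjOp B E) := by
        rw [← Algebra.algebraMap_eq_smul_one]
        exact h.trans (algebraMap_mono _ (le_max_left _ _))
      have h3 := smul_le_smul_of_nonneg_left h2 (inv_nonneg.2 hs0.le)
      rwa [smul_smul, inv_mul_cancel₀ hs0.ne', one_smul] at h3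
    · rw [smul_smul, ← Complex.ofReal_mul, mul_inv_cancel₀ hs0.ne', Complex.ofReal_one, one_smul]

theorem mem_H_of_mem_G {ρ : A →ₗ[ℂ] 𝓜(ℂ, B)} (h : ρ ∈ K.G) : ρ ∈ K.H := (mem_G_iff.1 h).1

theorem opT_le_one {ρ : A →ₗ[ℂ] 𝓜(ℂ, B)} (h : ρ ∈ K.G) : K.opT ρ ≤ 1 := by
  obtain ⟨-, t, -, ht1, h⟩ := mem_G_iff.1 h
  rw [← map_one (algebraMap ℝ (AdjOp B E))]
  exact h.trans (algebraMap_mono _ ht1.le)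

theorem zero_mem_G : (0 : A →ₗ[ℂ] 𝓜(ℂ, B)) ∈ K.G :=
  mem_G_iff.2 ⟨zero_mem_H.1, 0, le_rfl, one_pos, by rw [zero_mem_H.2, map_zero]⟩

/-- The transform of `k (T_ρ + T_η)` commutes with `π(A)` and is dominated by the operator of a
multiple of `ρ + η`, so it comes from a map in `𝓗_φ`. Beyond directedness, the last inequality
supplies the surplus that bounds the defect. -/
theorem exists_upper_bound_G (hN : φ.DenselyDefined) (hK : K.Nondegenerate)
    {ρ η : A →ₗ[ℂ] 𝓜(ℂ, B)} (hρ : ρ ∈ K.G) (hη : η ∈ K.G) :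
    ∃ ξ ∈ K.G, CPLe ρ ξ ∧ CPLe η ξ ∧
      K.opT ρ + (3⁻¹ : ℝ) • (K.opT ρ - K.opT ρ * K.opT ρ) ≤ K.opT ξ := by
  have hρ1 := opT_le_one hρ
  have hη1 := opT_le_one hη
  obtain ⟨hρH, t, ht0, ht1, ht⟩ := mem_G_iff.1 hρ
  obtain ⟨hηH, s, hs0, hs1, hs⟩ := mem_G_iff.1 hη
  obtain ⟨c, hc0, ⟨r, hr0, hr1, hcr⟩, ⟨k, hk0, hck⟩, hρc, hηc, hcomm⟩ :=
    exists_upper_bound (opT_nonneg hρH) (opT_nonneg hηH) (max_lt ht1 hs1)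
      (ht.trans (algebraMap_mono _ (le_max_left t s)))
      (hs.trans (algebraMap_mono _ (le_max_right t s)))
  obtain ⟨hsum, hsumT⟩ := add_mem_H hρH hηH
  obtain ⟨hk, hkT⟩ := smul_mem_H hsum hk0
  rw [hsumT] at hkT
  obtain ⟨ξ, hξ, hξT⟩ := exists_mem_H_of_le hN hK hc0
    (fun x => hcomm _ (commute_opT hρH x) (commute_opT hηH x)) hk (hkT ▸ hck)
  have hle : ∀ T : AdjOp B E, 0 ≤ T → T ≤ 1 → T ≤ T + (3⁻¹ : ℝ) • (T - T * T) := fun T h0 h1 =>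
    le_add_of_nonneg_right (smul_nonneg (by norm_num) (sub_nonneg.2 (mul_self_le_self h0 h1)))
  refine ⟨ξ, mem_G_iff.2 ⟨hξ, r, hr0, hr1, hξT ▸ hcr⟩, cpLe_of_opT_le hN hK hρH hξ ?_,
    cpLe_of_opT_le hN hK hηH hξ ?_, hξT ▸ hρc⟩
  · exact hξT ▸ (hle _ (opT_nonneg hρH) hρ1).trans hρc
  · exact hξT ▸ (hle _ (opT_nonneg hηH) hη1).trans hηc

theorem net_hasBasis (hN : φ.DenselyDefined) (hK : K.Nondegenerate) :
    K.net.HasBasis (· ∈ K.G) (fun ρ₀ => {ρ | ρ ∈ K.G ∧ CPLe ρ₀ ρ}) := by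
  refine hasBasis_biInf_principal ?_ ⟨0, zero_mem_G⟩
  intro ρ hρ η hη
  obtain ⟨ξ, hξ, h1, h2, -⟩ := exists_upper_bound_G hN hK hρ hη
  exact ⟨ξ, hξ, fun _ h => ⟨h.1, cpLe_trans h1 h.2⟩, fun _ h => ⟨h.1, cpLe_trans h2 h.2⟩⟩

theorem net_neBot (hN : φ.DenselyDefined) (hK : K.Nondegenerate) : K.net.NeBot :=
  (net_hasBasis hN hK).neBot_iff.2 fun {ρ} hρ => ⟨ρ, hρ, cpLe_refl ρ⟩

theorem eventually_net {ρ₀ : A →ₗ[ℂ] 𝓜(ℂ, B)} (h : ρ₀ ∈ K.G) :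
    ∀ᶠ ρ in K.net, ρ ∈ K.G ∧ CPLe ρ₀ ρ :=
  mem_iInf_of_mem ρ₀ (mem_iInf_of_mem h (mem_principal_self _))

theorem eventually_mem_G : ∀ᶠ ρ in K.net, ρ ∈ K.G :=
  (eventually_net zero_mem_G).mono fun _ h => h.1

/-! ### Consequences of regularity -/

variable {I : Type*} [Preorder I] {u : I → 𝓜(ℂ, A)}

/-- A truncating net yields elements `ρ` of `𝓕_φ` whose operators `T_ρ = S* S` approximate `1`. -/
theorem IsTruncatingNet.exists_F (h : K.IsTruncatingNet u) : ∃ S : I → AdjOp B E,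
    (∀ i, K.InCommutant (S i).1) ∧ (∀ i, ∃ ρ ∈ K.F, K.opT ρ = star (S i) * S i) ∧
    ∀ x, Tendsto (fun i => (S i).1 x) atTop (𝓝 x) := by
  obtain ⟨hNu, S, hadj, hΛ, -, hS, hρ, -, hlim⟩ := h
  refine ⟨fun i => AdjOp.mk (S i) (hadj i), fun i => InCommutant.of_Λ K fun x a b => ?_,
    fun i => ?_, hlim⟩
  · have h1 : ∀ (c : φ.N) (b : B), S i (K.Λ c b) = K.Λ ⟨(u i).snd (c : A), hNu i c⟩ b :=
      fun c b => congrArg (fun T : B →L[ℂ] E => T b) (hΛ i c)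
    change S i (K.π x (K.Λ a b)) = K.π x (S i (K.Λ a b))
    rw [K.π_Λ, h1, h1, K.π_Λ]
    congr 2
    exact Subtype.ext (multiplier_snd_mul _ _ _)
  · obtain ⟨ρ, hstr, hcp, hform⟩ := hρ i
    set T : AdjOp B E := AdjOp.mk (S i) (hadj i)
    obtain ⟨hH, hT⟩ := mem_H (K := K) hstr hcp (star_mul_self_nonneg T) fun a₁ a₂ b₁ b₂ => by
      rw [AdjOp.mul_apply, ip_apply_left, star_star, hform]
      rfl
    refine ⟨ρ, mem_F_iff.2 ⟨hH, ?_⟩, hT⟩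
    rw [hT]
    have h2 : ‖star T * T‖ ≤ 1 := by
      rw [CStarRing.norm_star_mul_self]
      exact mul_le_one₀ (hS i) (norm_nonneg _) (hS i)
    exact (CStarAlgebra.norm_le_one_iff_of_nonneg _ (star_mul_self_nonneg T)).1 h2

variable [IsDirectedOrder I] [Nonempty I]

/-- Each `S i` is dominated, so `S i x` lies in the closed span of `π(A) E`, and `S i x → x`. -/
theorem nondegenerate_of_truncating (h : K.IsTruncatingNet u) : K.Nondegenerate := by
  obtain ⟨S, hcomm, hF, hlim⟩ := h.exists_F
  intro x
  rw [← Submodule.topologicalClosure_coe]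
  refine (Submodule.isClosed_topologicalClosure _).mem_of_tendsto (hlim x)
    (Eventually.of_forall fun i => ?_)
  obtain ⟨ρ, hρ, hT⟩ := hF i
  exact mem_closure_of_dominated (dominated_of_le (mem_F_iff.1 hρ).1 hT.ge) (mem_F_iff.1 hρ).1.1
    (hcomm i) x

theorem tendsto_one_sub_opT (h : K.IsTruncatingNet u) (x : E) :
    Tendsto (fun ρ => ⟪(1 - K.opT ρ).1 x, x⟫) K.net (𝓝 0) := by
  obtain ⟨S, hcomm, hF, hlim⟩ := h.exists_F
  rw [Metric.tendsto_nhds]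
  intro ε hε
  have h1 : Tendsto (fun i => ⟪(S i).1 x, (S i).1 x⟫) atTop (𝓝 ⟪x, x⟫) := (hlim x).ip B (hlim x)
  obtain ⟨i, hi⟩ := (Metric.tendsto_nhds.1 h1 (ε / 2) (by positivity)).exists
  obtain ⟨ρ, hρ, hT⟩ := hF i
  obtain ⟨hρH, hρ1⟩ := mem_F_iff.1 hρ
  set M := ‖⟪(K.opT ρ).1 x, x⟫‖
  have hM : 0 ≤ M := norm_nonneg _
  -- The map `ρ` is only in `𝓕_φ`, so it is shrunk by `1 - s` to enter `𝓖_φ`; this costs `s M < ε /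
  -- 2` in the form at `x`.
  set s : ℝ := ε / (2 * (M + ε)) with hs
  have hs0 : 0 < s := by positivity
  have hs1 : s ≤ 1 := by
    rw [hs, div_le_one (by positivity)]
    linarith
  have hsM : s * M < ε / 2 := by
    rw [hs, div_mul_eq_mul_div, div_lt_div_iff₀ (by positivity) two_pos]
    nlinarith
  have hG : ((1 - s : ℝ) : ℂ) • ρ ∈ K.G := ⟨1 - s, by linarith, by linarith, ρ, hρ, rfl⟩
  filter_upwards [eventually_net hG] with η hη
  have hle := opT_mono _ _ (mem_H_of_mem_G hG) (mem_H_of_mem_G hη.1) hη.2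
  rw [(smul_mem_H hρH (by linarith)).2] at hle
  rw [dist_zero_right]
  refine (norm_ip_mono (sub_nonneg.2 (opT_le_one hη.1)) (sub_le_sub_left hle 1) x).trans_lt ?_
  have e : ⟪(1 - (1 - s) • K.opT ρ).1 x, x⟫ =
      (⟪x, x⟫ - ⟪(S i).1 x, (S i).1 x⟫) + (s : ℂ) • ⟪(K.opT ρ).1 x, x⟫ := by
    have e1 : ⟪(S i).1 x, (S i).1 x⟫ = ⟪(K.opT ρ).1 x, x⟫ := by
      rw [hT, AdjOp.mul_apply, ip_apply_left (star (S i)), star_star]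
    rw [e1, ← Complex.coe_smul, AdjOp.sub_apply, AdjOp.one_apply, ip_sub_left, AdjOp.smul_apply,
      HilbertModule.ip_smul_left, Complex.ofReal_sub, sub_smul, Complex.ofReal_one, one_smul]
    abel
  rw [e]
  refine (norm_add_le _ _).trans_lt ?_
  rw [norm_smul, Complex.norm_real, Real.norm_of_nonneg hs0.le]
  rw [dist_comm, dist_eq_norm] at hi
  linarith

end KSGNS

end CValued

namespace CValued

namespace KSGNS

variable {A B E : Type*} [NonUnitalCStarAlgebra A] [PartialOrder A] [StarOrderedRing A]
  [NonUnitalCStarAlgebra B] [PartialOrder B] [StarOrderedRing B]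
  [NormedAddCommGroup E] [NormedSpace ℂ E] [CompleteSpace E] [HilbertModule B E]
  {φ : CStarWeight A B} {K : KSGNS φ E}

local notation "⟪" x ", " y "⟫" => HilbertModule.ip (B := B) x y

/-! ### Implemented operators -/

/-- The element `m a` of `𝓝_φ`, for `m ∈ M(A)` and `a ∈ 𝓝_φ`. -/
noncomputable def mulN (m : 𝓜(ℂ, A)) (a : φ.N) : φ.N :=
  ⟨m.fst a, φ.cone.multiplier_mem_leftIdeal m a.2⟩

/-- For `n` in `𝓝_φ`, `S Λ(m n) b = π(m) π(n) v b`. Thus `π(m) v b` stands in for `S Λ(m) b` when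
`m` is outside `𝓝_φ`. -/
theorem tendsto_Λ_mulN (hK : K.Nondegenerate) {S : E →L[ℂ] E} {v : B →L[ℂ] E}
    (h : K.Implements S v) (m : 𝓜(ℂ, A)) (b : B) :
    Tendsto (fun n : φ.N => S (K.Λ (mulN m n) b)) φ.cone.approxUnit (𝓝 (K.πM m (v b))) := by
  have h1 := tendsto_π_of_strict hK (m := 1) φ.cone.approxUnit_norm φ.cone.approxUnit_mul_right
    (v b)
  rw [πM_eq hK (T := ContinuousLinearMap.id ℂ E) (fun c y => rfl)] at h1
  refine (((K.πM m).continuous.tendsto _).comp h1).congr fun n => ?_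
  rw [h.apply, Function.comp_apply, πM_apply hK]
  rfl

theorem Implements.mul_left {S R : AdjOp B E} {v : B →L[ℂ] E} (h : K.Implements S.1 v)
    (hR : K.InCommutant R.1) : K.Implements (R * S).1 (R.1 ∘L v) := by
  obtain ⟨v', hv⟩ := h.1
  refine ⟨⟨_, (adjPair_star R).comp hv⟩, fun c => ContinuousLinearMap.ext fun b => ?_⟩
  simp only [ContinuousLinearMap.comp_apply]
  rw [AdjOp.mul_apply, h.apply]
  exact congrArg (fun T : E →L[ℂ] E => T (v b)) (hR c)

theorem Implements.sub {S R : AdjOp B E} {v w : B →L[ℂ] E} (h : K.Implements S.1 v)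
    (h' : K.Implements R.1 w) : K.Implements (S - R).1 (v - w) := by
  obtain ⟨v', hv⟩ := h.1
  obtain ⟨w', hw⟩ := h'.1
  refine ⟨⟨v' - w', fun x y => ?_⟩, fun c => ContinuousLinearMap.ext fun b => ?_⟩
  · rw [sub_apply, sub_apply, ip_sub_left, ip_sub_right, hv, hw]
  · simp only [ContinuousLinearMap.comp_apply]
    rw [AdjOp.sub_apply, h.apply, h'.apply, sub_apply, map_sub]

theorem norm_sq_le_of_le (hN : φ.DenselyDefined) (hK : K.Nondegenerate) {R₁ R₂ : AdjOp B E}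
    {v₁ v₂ : B →L[ℂ] E} (h₁ : K.Implements R₁.1 v₁) (h₂ : K.Implements R₂.1 v₂) {C : ℝ}
    (hC : 0 ≤ C) (h : star R₁ * R₁ ≤ C • (star R₂ * R₂)) (m : 𝓜(ℂ, A)) (b : B) :
    ‖K.πM m (v₁ b)‖ ^ 2 ≤ C * ‖K.πM m (v₂ b)‖ ^ 2 := by
  have := φ.cone.approxUnit_neBot hN
  refine le_of_tendsto_of_tendsto' ((tendsto_Λ_mulN hK h₁ m b).norm.pow 2)
    (((tendsto_Λ_mulN hK h₂ m b).norm.pow 2).const_mul C) fun n => ?_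
  rw [norm_sq_apply, norm_sq_apply]
  refine (norm_ip_mono (star_mul_self_nonneg R₁) h _).trans_eq ?_
  rw [← Complex.coe_smul, AdjOp.smul_apply, HilbertModule.ip_smul_left, norm_smul,
    Complex.norm_real, Real.norm_of_nonneg hC]

theorem star_sqrt (T : AdjOp B E) : star (CFC.sqrt T) = CFC.sqrt T :=
  (IsSelfAdjoint.of_nonneg (CFC.sqrt_nonneg T)).star_eq

theorem star_sqrt_mul_sqrt {T : AdjOp B E} (h : 0 ≤ T) : star (CFC.sqrt T) * CFC.sqrt T = T := by
  rw [star_sqrt, CFC.sqrt_mul_sqrt_self T h]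

theorem inCommutant_sqrt {ρ : A →ₗ[ℂ] 𝓜(ℂ, B)} (hρ : ρ ∈ K.H) :
    K.InCommutant (CFC.sqrt (K.opT ρ)).1 :=
  inCommutant_iff.2 fun x => commute_sqrt (commute_opT hρ x)

theorem implements_v (hN : φ.DenselyDefined) (hK : K.Nondegenerate) {ρ : A →ₗ[ℂ] 𝓜(ℂ, B)}
    (hρ : ρ ∈ K.H) : K.Implements (CFC.sqrt (K.opT ρ)).1 (K.v ρ) := by
  have h := exists_implements_of_le hN hK hρ (star_sqrt_mul_sqrt (opT_nonneg hρ)).le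
    (inCommutant_sqrt hρ)
  rw [← sqrtOp_eq (opT_nonneg hρ), ← T_eq hρ] at h ⊢
  exact Classical.epsilon_spec h

/-- Translates the convergence condition defining `Ñ_φ` into convergence of squares of half vectors,
through `ρ = v_ρ* π(·) v_ρ`. -/
theorem star_mul_strictExtension (hN : φ.DenselyDefined) (hK : K.Nondegenerate)
    {ρ : A →ₗ[ℂ] 𝓜(ℂ, B)} (hρ : ρ ∈ K.H) (a : 𝓜(ℂ, A)) (b : B) :
    star b * (strictExtension ρ (star a * a)).fst b =
      ⟪K.πM a (K.v ρ b), K.πM a (K.v ρ b)⟫ := by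
  have hv := implements_v hN hK hρ
  obtain ⟨v', hvv⟩ := hv.1
  have h : strictExtension ρ = compression hK hvv :=
    (congrArg strictExtension (eq_compressionA hN hK hv hvv hρ
      (star_sqrt_mul_sqrt (opT_nonneg hρ)))).trans (strictExtension_compressionA hK hvv)
  rw [h, star_mul_compression_fst, πM_mul hK, ContinuousLinearMap.comp_apply]
  exact (adjPair_πM hK a).symm _ _

/-- The vector `T_ρ^{1/2} Λ(a) b = π(a) v_ρ b`. -/
noncomputable abbrev halfVec (K : KSGNS φ E) (a : 𝓜(ℂ, A)) (b : B) (ρ : A →ₗ[ℂ] 𝓜(ℂ, B)) : E :=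
  K.πM a (K.v ρ b)

/-- The vector `T_ρ Λ(a) b = T_ρ^{1/2} π(a) v_ρ b`. -/
noncomputable def fullVec (K : KSGNS φ E) (a : 𝓜(ℂ, A)) (b : B) (ρ : A →ₗ[ℂ] 𝓜(ℂ, B)) : E :=
  (CFC.sqrt (K.opT ρ)).1 (K.halfVec a b ρ)

theorem tendsto_halfVec (hN : φ.DenselyDefined) (hK : K.Nondegenerate) {ρ : A →ₗ[ℂ] 𝓜(ℂ, B)}
    (hρ : ρ ∈ K.H) (a : 𝓜(ℂ, A)) (b : B) :
    Tendsto (fun n : φ.N => (CFC.sqrt (K.opT ρ)).1 (K.Λ (mulN a n) b)) φ.cone.approxUnit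
      (𝓝 (K.halfVec a b ρ)) :=
  tendsto_Λ_mulN hK (implements_v hN hK hρ) a b

theorem tendsto_fullVec (hN : φ.DenselyDefined) (hK : K.Nondegenerate) {ρ : A →ₗ[ℂ] 𝓜(ℂ, B)}
    (hρ : ρ ∈ K.H) (a : 𝓜(ℂ, A)) (b : B) :
    Tendsto (fun n : φ.N => (K.opT ρ).1 (K.Λ (mulN a n) b)) φ.cone.approxUnit
      (𝓝 (K.fullVec a b ρ)) :=
  ((((CFC.sqrt (K.opT ρ)).1.continuous.tendsto _).comp (tendsto_halfVec hN hK hρ a b))).congr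
    fun _ => sqrt_sq_apply (opT_nonneg hρ) _

theorem ip_sqrt_sqrt {T : AdjOp B E} (h : 0 ≤ T) (x : E) :
    ⟪(CFC.sqrt T).1 x, (CFC.sqrt T).1 x⟫ = ⟪T.1 x, x⟫ := by
  rw [ip_apply_right, star_sqrt, sqrt_sq_apply h]

/-- The inequality `D² ≤ D` for `D = T_η - T_ρ`, tested on `Λ(a n) b` and passed to the limit. -/
theorem norm_fullVec_sub_sq_le (hN : φ.DenselyDefined) (hK : K.Nondegenerate)
    {ρ η : A →ₗ[ℂ] 𝓜(ℂ, B)} (hρ : ρ ∈ K.G) (hη : η ∈ K.G) (h : CPLe ρ η) (a : 𝓜(ℂ, A)) (b : B) :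
    ‖K.fullVec a b η - K.fullVec a b ρ‖ ^ 2 ≤
      ‖⟪K.halfVec a b η, K.halfVec a b η⟫ - ⟪K.halfVec a b ρ, K.halfVec a b ρ⟫‖ := by
  have := φ.cone.approxUnit_neBot hN
  have hρH := mem_H_of_mem_G hρ
  have hηH := mem_H_of_mem_G hη
  have hD0 : 0 ≤ K.opT η - K.opT ρ := sub_nonneg.2 (opT_mono _ _ hρH hηH h)
  have hD1 : K.opT η - K.opT ρ ≤ 1 := (sub_le_self _ (opT_nonneg hρH)).trans (opT_le_one hη)
  have h1 := tendsto_halfVec hN hK hρH a b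
  have h2 := tendsto_halfVec hN hK hηH a b
  refine le_of_tendsto_of_tendsto'
    (((tendsto_fullVec hN hK hηH a b).sub (tendsto_fullVec hN hK hρH a b)).norm.pow 2)
    ((h2.ip B h2).sub (h1.ip B h1)).norm fun n => ?_
  rw [ip_sqrt_sqrt (opT_nonneg hρH), ip_sqrt_sqrt (opT_nonneg hηH), ← ip_sub_left,
    ← AdjOp.sub_apply]
  exact norm_sq_le_norm_ip hD0 hD1 _

/-- The defect is the limit of the form of `T_ρ - T_ρ²` at `Λ(a n) b`, and the surplus in
`exists_upper_bound_G`, used with both maps equal to `ρ`, bounds that form by `3 (T_η - T_ρ)`. -/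
theorem norm_ip_halfVec_le (hN : φ.DenselyDefined) (hK : K.Nondegenerate)
    {ρ : A →ₗ[ℂ] 𝓜(ℂ, B)} (hρ : ρ ∈ K.G) (a : 𝓜(ℂ, A)) (b : B) : ∃ η ∈ K.G, CPLe ρ η ∧
      ‖⟪(1 - K.opT ρ).1 (K.halfVec a b ρ), K.halfVec a b ρ⟫‖ ≤ 3 *
      ‖⟪K.halfVec a b η, K.halfVec a b η⟫ - ⟪K.halfVec a b ρ, K.halfVec a b ρ⟫‖ := by
  obtain ⟨η, hη, hρη, -, hle⟩ := exists_upper_bound_G hN hK hρ hρ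
  refine ⟨η, hη, hρη, ?_⟩
  have := φ.cone.approxUnit_neBot hN
  have hρH := mem_H_of_mem_G hρ
  have hηH := mem_H_of_mem_G hη
  have h1 := tendsto_halfVec hN hK hρH a b
  have h2 := tendsto_halfVec hN hK hηH a b
  have hT0 := opT_nonneg hρH
  have hTT : 0 ≤ K.opT ρ - K.opT ρ * K.opT ρ := sub_nonneg.2 (mul_self_le_self hT0 (opT_le_one hρ))
  refine le_of_tendsto_of_tendsto'
    ((((1 - K.opT ρ).1.continuous.tendsto _).comp h1).ip B h1).norm
    (((h2.ip B h2).sub (h1.ip B h1)).norm.const_mul 3) fun n => ?_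
  set x := K.Λ (mulN a n) b
  rw [ip_sqrt_sqrt hT0, ip_sqrt_sqrt (opT_nonneg hηH), ← ip_sub_left, ← AdjOp.sub_apply]
  have hs := CFC.sqrt_mul_sqrt_self (K.opT ρ) hT0
  have e : CFC.sqrt (K.opT ρ) * ((1 - K.opT ρ) * CFC.sqrt (K.opT ρ)) =
      K.opT ρ - K.opT ρ * K.opT ρ := by
    generalize CFC.sqrt (K.opT ρ) = s at hs
    rw [← hs]
    noncomm_ring
  have e2 : ⟪(1 - K.opT ρ).1 ((CFC.sqrt (K.opT ρ)).1 x), (CFC.sqrt (K.opT ρ)).1 x⟫ =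
      ⟪(K.opT ρ - K.opT ρ * K.opT ρ).1 x, x⟫ := by
    rw [ip_apply_right, star_sqrt, ← e, AdjOp.mul_apply, AdjOp.mul_apply]
  have h3 := norm_ip_mono (smul_nonneg (by norm_num : (0 : ℝ) ≤ 3⁻¹) hTT)
    (le_sub_iff_add_le'.2 hle) x
  rw [← Complex.coe_smul, AdjOp.smul_apply, HilbertModule.ip_smul_left, norm_smul,
    Complex.norm_real, Real.norm_of_nonneg (by norm_num)] at h3
  rw [Function.comp_apply, e2]
  linarith

/-- The map `v - S T_η^{1/2} v_η` implements `S (1 - T_η)`, while `(1 - T_η) v_η` implements `(1 -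
T_η) T_η^{1/2}`. Conjugating `S* S ≤ C T_η` by `1 - T_η` compares the two, and `(1 - T_η)² ≤ 1 -
T_η` leaves the defect. -/
theorem norm_sub_apply_fullVec_sq_le (hN : φ.DenselyDefined) (hK : K.Nondegenerate)
    {S : AdjOp B E} (hS : K.InCommutant S.1) {v : B →L[ℂ] E} (hv : K.Implements S.1 v)
    {η : A →ₗ[ℂ] 𝓜(ℂ, B)} (hη : η ∈ K.G) {C : ℝ} (hC : 0 ≤ C) (hle : star S * S ≤ C • K.opT η)
    (a : 𝓜(ℂ, A)) (b : B) : ‖K.πM a (v b) - S.1 (K.fullVec a b η)‖ ^ 2 ≤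
      C * ‖⟪(1 - K.opT η).1 (K.halfVec a b η), K.halfVec a b η⟫‖ := by
  have hηH := mem_H_of_mem_G hη
  have hT0 := opT_nonneg hηH
  have hvη := implements_v hN hK hηH
  have hcs := inCommutant_sqrt hηH
  have hc1 : K.InCommutant (1 - K.opT η).1 :=
    inCommutant_iff.2 fun x => (Commute.one_left _).sub_left (commute_opT hηH x)
  have h1 := hv.sub ((hvη.mul_left hcs).mul_left hS)
  have h2 := hvη.mul_left hc1
  have hs := CFC.sqrt_mul_sqrt_self (K.opT η) hT0
  have hsT : star (K.opT η) = K.opT η := (IsSelfAdjoint.of_nonneg hT0).star_eq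
  have h3 := norm_sq_le_of_le hN hK h1 h2 hC (by
    have h4 := star_left_conjugate_le_conjugate hle (1 - K.opT η)
    rw [star_sub, star_one, hsT] at h4
    convert h4 using 1
    · rw [hs, star_sub, star_mul, hsT]
      noncomm_ring
    · rw [star_mul, star_sqrt, star_sub, star_one, hsT, mul_smul_comm, smul_mul_assoc]
      congr 1
      generalize CFC.sqrt (K.opT η) = s at hs
      rw [← hs]
      noncomm_ring) a b
  have e1 : K.πM a ((v - S.1 ∘L ((CFC.sqrt (K.opT η)).1 ∘L K.v η)) b) =
      K.πM a (v b) - S.1 (K.fullVec a b η) := by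
    rw [sub_apply, map_sub, ContinuousLinearMap.comp_apply, ContinuousLinearMap.comp_apply,
      ← inCommutant_πM hK hS, ← inCommutant_πM hK hcs]
    rfl
  have e2 : K.πM a (((1 - K.opT η).1 ∘L K.v η) b) = (1 - K.opT η).1 (K.halfVec a b η) := by
    rw [ContinuousLinearMap.comp_apply, ← inCommutant_πM hK hc1]
  rw [e1, e2] at h3
  refine h3.trans (mul_le_mul_of_nonneg_left ?_ hC)
  exact norm_sub_apply_sq_le hT0 (opT_le_one hη) _

/-! ### Convergence of the vectors `π(a) v_ρ b` -/

theorem tendsto_ip_halfVec_iff (hN : φ.DenselyDefined) (hK : K.Nondegenerate) (a : 𝓜(ℂ, A)) (b : B)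
    (y : B) : Tendsto (fun ρ => star b * (strictExtension ρ (star a * a)).fst b) K.net (𝓝 y) ↔
      Tendsto (fun ρ => ⟪K.halfVec a b ρ, K.halfVec a b ρ⟫) K.net (𝓝 y) :=
  tendsto_congr' (eventually_mem_G.mono fun _ hρ =>
    star_mul_strictExtension hN hK (mem_H_of_mem_G hρ) a b)

theorem exists_forall_dist_lt (hN : φ.DenselyDefined) (hK : K.Nondegenerate)
    {q : (A →ₗ[ℂ] 𝓜(ℂ, B)) → B} {y : B} (h : Tendsto q K.net (𝓝 y)) {ε : ℝ} (hε : 0 < ε) :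
    ∃ ρ₀ ∈ K.G, ∀ ρ ∈ K.G, CPLe ρ₀ ρ → ∀ η ∈ K.G, CPLe ρ₀ η → ‖q η - q ρ‖ < ε := by
  obtain ⟨ρ₀, hρ₀, h1⟩ := (net_hasBasis hN hK).eventually_iff.1
    (Metric.tendsto_nhds.1 h (ε / 2) (by positivity))
  refine ⟨ρ₀, hρ₀, fun ρ hρ hle η hη hle' => ?_⟩
  have h2 := h1 ⟨hρ, hle⟩
  have h3 := h1 ⟨hη, hle'⟩
  rw [← dist_eq_norm]
  linarith [dist_triangle_right (q η) (q ρ) y]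

theorem tendsto_defect (hN : φ.DenselyDefined) (hK : K.Nondegenerate) {a : 𝓜(ℂ, A)} {b : B} {y : B}
    (h : Tendsto (fun ρ => ⟪K.halfVec a b ρ, K.halfVec a b ρ⟫) K.net (𝓝 y)) :
    Tendsto (fun ρ => ‖⟪(1 - K.opT ρ).1 (K.halfVec a b ρ), K.halfVec a b ρ⟫‖) K.net (𝓝 0) := by
  rw [Metric.tendsto_nhds]
  intro ε hε
  obtain ⟨ρ₀, hρ₀, h1⟩ := exists_forall_dist_lt hN hK h (ε := ε / 3) (by positivity)
  filter_upwards [eventually_net hρ₀] with ρ hρ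
  obtain ⟨η, hη, hle, h2⟩ := norm_ip_halfVec_le hN hK hρ.1 a b
  have h3 := h1 ρ hρ.1 hρ.2 η hη (cpLe_trans hρ.2 hle)
  rw [dist_zero_right, norm_norm]
  linarith

theorem tendsto_halfVec_sub_fullVec (hN : φ.DenselyDefined) (hK : K.Nondegenerate) {a : 𝓜(ℂ, A)}
    {b : B} {y : B} (h : Tendsto (fun ρ => ⟪K.halfVec a b ρ, K.halfVec a b ρ⟫) K.net (𝓝 y)) :
    Tendsto (fun ρ => K.halfVec a b ρ - K.fullVec a b ρ) K.net (𝓝 0) := by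
  have h1 : Tendsto (fun ρ => ‖K.halfVec a b ρ - K.fullVec a b ρ‖ ^ 2) K.net (𝓝 0) :=
    squeeze_zero' (Eventually.of_forall fun _ => by positivity)
      (eventually_mem_G.mono fun ρ hρ =>
        norm_sub_sqrt_sq_le (opT_nonneg (mem_H_of_mem_G hρ)) (opT_le_one hρ) _)
      (tendsto_defect hN hK h)
  have h2 := (Real.continuous_sqrt.tendsto 0).comp h1
  rw [Real.sqrt_zero] at h2
  exact tendsto_zero_iff_norm_tendsto_zero.2 (h2.congr fun _ => Real.sqrt_sq (norm_nonneg _))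

/-- The increments estimated in `norm_fullVec_sub_sq_le` are those of full vectors, so these are
shown to be Cauchy first; the half vectors differ from them by a null net. -/
theorem exists_tendsto_halfVec (hN : φ.DenselyDefined) (hK : K.Nondegenerate) {a : 𝓜(ℂ, A)}
    {b : B} {y : B} (h : Tendsto (fun ρ => ⟪K.halfVec a b ρ, K.halfVec a b ρ⟫) K.net (𝓝 y)) :
    ∃ x, Tendsto (K.halfVec a b) K.net (𝓝 x) := by
  have hne := net_neBot hN hK
  have hcauchy : Cauchy (map (K.fullVec a b) K.net) := by
    refine Metric.cauchy_iff.2 ⟨inferInstance, fun ε hε => ?_⟩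
    obtain ⟨ρ₀, hρ₀, h1⟩ := exists_forall_dist_lt hN hK h (ε := (ε / 2) ^ 2) (by positivity)
    have h2 : ∀ ρ ∈ K.G, CPLe ρ₀ ρ → dist (K.fullVec a b ρ) (K.fullVec a b ρ₀) < ε / 2 := by
      intro ρ hρ hle
      rw [dist_eq_norm]
      exact lt_of_pow_lt_pow_left₀ 2 (by positivity)
        ((norm_fullVec_sub_sq_le hN hK hρ₀ hρ hle a b).trans_lt
          (h1 ρ₀ hρ₀ (cpLe_refl _) ρ hρ hle))
    refine ⟨Metric.ball (K.fullVec a b ρ₀) (ε / 2), ?_, fun x hx z hz => ?_⟩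
    · exact (eventually_net hρ₀).mono fun ρ hρ => h2 ρ hρ.1 hρ.2
    · rw [Metric.mem_ball] at hx hz
      linarith [dist_triangle_right x z (K.fullVec a b ρ₀)]
  obtain ⟨x, hx⟩ := CompleteSpace.complete hcauchy
  refine ⟨x, ?_⟩
  simpa using (tendsto_halfVec_sub_fullVec hN hK h).add (hx : Tendsto (K.fullVec a b) K.net (𝓝 x))

theorem apply_limit_halfVec (hN : φ.DenselyDefined) (hK : K.Nondegenerate) {a : 𝓜(ℂ, A)} {b : B}
    {x : E} (hx : Tendsto (K.halfVec a b) K.net (𝓝 x)) {ρ : A →ₗ[ℂ] 𝓜(ℂ, B)} (hρ : ρ ∈ K.F)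
    {S : AdjOp B E} (hS : K.InCommutant S.1) (hST : star S * S = K.opT ρ) {v : B →L[ℂ] E}
    (hv : K.Implements S.1 v) : S.1 x = K.πM a (v b) := by
  have hne := net_neBot hN hK
  have hq : Tendsto (fun ρ => ⟪K.halfVec a b ρ, K.halfVec a b ρ⟫) K.net (𝓝 ⟪x, x⟫) := hx.ip B hx
  have hfull : Tendsto (K.fullVec a b) K.net (𝓝 x) := by
    simpa using hx.sub (tendsto_halfVec_sub_fullVec hN hK hq)
  -- Since `ρ` itself need not lie in `𝓖_φ`, its half is used; beyond it `T_ρ ≤ 2 T_η`, which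
  -- explains the constant `2` below.
  have hG : ((1 / 2 : ℝ) : ℂ) • ρ ∈ K.G := ⟨1 / 2, by norm_num, by norm_num, ρ, hρ, rfl⟩
  have h1 : Tendsto (fun η => ‖K.πM a (v b) - S.1 (K.fullVec a b η)‖ ^ 2) K.net (𝓝 0) := by
    have h2 := (tendsto_defect hN hK hq).const_mul 2
    rw [mul_zero] at h2
    refine squeeze_zero' (Eventually.of_forall fun _ => by positivity) ?_ h2
    filter_upwards [eventually_net hG] with η hη
    refine norm_sub_apply_fullVec_sq_le hN hK hS hv hη.1 zero_le_two ?_ a b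
    have h3 := opT_mono _ _ (mem_H_of_mem_G hG) (mem_H_of_mem_G hη.1) hη.2
    rw [(smul_mem_H (mem_F_iff.1 hρ).1 (by norm_num)).2] at h3
    have h4 := smul_le_smul_of_nonneg_left h3 (zero_le_two (α := ℝ))
    rw [smul_smul] at h4
    norm_num at h4
    rw [hST]
    exact h4
  have h2 : Tendsto (fun η => ‖K.πM a (v b) - S.1 (K.fullVec a b η)‖ ^ 2) K.net
      (𝓝 (‖K.πM a (v b) - S.1 x‖ ^ 2)) :=
    (tendsto_const_nhds.sub ((S.1.continuous.tendsto x).comp hfull)).norm.pow 2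
  have h3 := tendsto_nhds_unique h1 h2
  have h4 : ‖K.πM a (v b) - S.1 x‖ = 0 := by
    simpa using h3.symm
  exact (sub_eq_zero.1 (norm_eq_zero.1 h4)).symm

theorem sqrt_apply_limit_halfVec (hN : φ.DenselyDefined) (hK : K.Nondegenerate) {a : 𝓜(ℂ, A)}
    {b : B} {x : E} (hx : Tendsto (K.halfVec a b) K.net (𝓝 x)) {ρ : A →ₗ[ℂ] 𝓜(ℂ, B)}
    (hρ : ρ ∈ K.G) : (CFC.sqrt (K.opT ρ)).1 x = K.halfVec a b ρ :=
  apply_limit_halfVec hN hK hx (mem_F_iff.2 ⟨mem_H_of_mem_G hρ, opT_le_one hρ⟩)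
    (inCommutant_sqrt (mem_H_of_mem_G hρ)) (star_sqrt_mul_sqrt (opT_nonneg (mem_H_of_mem_G hρ)))
    (implements_v hN hK (mem_H_of_mem_G hρ))

/-! ### The operator `Λ(a)` -/

theorem graph_Λtilde (hN : φ.DenselyDefined) (hK : K.Nondegenerate) (a : 𝓜(ℂ, A)) :
    (K.Λtilde a).graph = K.ΛtildeGraph a := by
  have := net_neBot hN hK
  refine Submodule.toLinearPMap_graph_eq _ fun p hp h0 => ?_
  have h1 : Tendsto (fun ρ => K.πM a (K.v ρ p.1)) K.net (𝓝 p.2) := hp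
  rw [h0] at h1
  simp only [map_zero] at h1
  exact tendsto_nhds_unique h1 tendsto_const_nhds

theorem tendsto_Λtilde (hN : φ.DenselyDefined) (hK : K.Nondegenerate) (a : 𝓜(ℂ, A))
    (b : (K.Λtilde a).domain) :
    Tendsto (fun ρ => K.πM a (K.v ρ (b : B))) K.net (𝓝 (K.Λtilde a b)) := by
  have h : ((b : B), K.Λtilde a b) ∈ K.ΛtildeGraph a := by
    rw [← graph_Λtilde hN hK]
    exact LinearPMap.mem_graph _ b
  exact h

variable {I : Type*} [Preorder I] {u : I → 𝓜(ℂ, A)} [IsDirectedOrder I] [Nonempty I]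

theorem tendsto_sqrt_opT (h : K.IsTruncatingNet u) (x : E) :
    Tendsto (fun ρ => (CFC.sqrt (K.opT ρ)).1 x) K.net (𝓝 x) := by
  have h0 : Tendsto (fun ρ => ‖⟪(1 - K.opT ρ).1 x, x⟫‖) K.net (𝓝 0) := by
    simpa using (tendsto_one_sub_opT h x).norm
  have h1 : Tendsto (fun ρ => ‖x - (CFC.sqrt (K.opT ρ)).1 x‖ ^ 2) K.net (𝓝 0) :=
    squeeze_zero' (Eventually.of_forall fun _ => by positivity)
      (eventually_mem_G.mono fun ρ hρ =>
        norm_sub_sqrt_sq_le (opT_nonneg (mem_H_of_mem_G hρ)) (opT_le_one hρ) _) h0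
  have h2 := (Real.continuous_sqrt.tendsto 0).comp h1
  rw [Real.sqrt_zero] at h2
  refine tendsto_iff_norm_sub_tendsto_zero.2 (h2.congr fun ρ => ?_)
  rw [norm_sub_rev]
  exact Real.sqrt_sq (norm_nonneg _)

end KSGNS

end CValued

/-! ### Domain, intertwining, closedness and adjoint of `Λ(a)` -/

theorem proposition8p1
    {A B E : Type*} [NonUnitalCStarAlgebra A] [PartialOrder A] [StarOrderedRing A]
    [NonUnitalCStarAlgebra B] [PartialOrder B] [StarOrderedRing B]
    [NormedAddCommGroup E] [NormedSpace ℂ E] [CompleteSpace E] [CValued.HilbertModule B E]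
    (φ : CValued.CStarWeight A B) (K : CValued.KSGNS φ E)
    {I : Type*} [Preorder I] [IsDirectedOrder I] [Nonempty I] (u : I → 𝓜(ℂ, A))
    (hreg : K.IsRegular u) (a : 𝓜(ℂ, A)) (ha : a ∈ K.Ntilde) :
    -- `Λ(a)` is well defined: its values are the limits of the nets `π(a) v_ρ b`
    (∀ b : (K.Λtilde a).domain,
      Tendsto (fun ρ => K.πM a (K.v ρ (b : B))) K.net (𝓝 (K.Λtilde a b))) ∧
    -- the domain of `Λ(a)`
    ((K.Λtilde a).domain : Set B) =
      {b : B | ∃ y : B, Tendsto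
        (fun ρ => star b * (CValued.strictExtension ρ (star a * a)).fst b) K.net (𝓝 y)} ∧
    -- `S Λ(a) b = π(a) v b`
    (∀ ρ ∈ K.F, ∀ S S' : E →L[ℂ] E, CValued.AdjPair B S S' → K.InCommutant S →
      S' ∘L S = K.T ρ →
      (∃! v : B →L[ℂ] E, K.Implements S v) ∧
      ∀ v : B →L[ℂ] E, K.Implements S v →
        ∀ b : (K.Λtilde a).domain, S (K.Λtilde a b) = K.πM a (v (b : B))) ∧
    -- `Λ(a)` is a closed densely defined `B`-linear map with densely defined adjoint
    (∀ (b : (K.Λtilde a).domain) (c : B), ∃ hbc : (b : B) * c ∈ (K.Λtilde a).domain,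
      K.Λtilde a ⟨(b : B) * c, hbc⟩ = CValued.HilbertModule.act (K.Λtilde a b) c) ∧
    (K.Λtilde a).IsClosed ∧ Dense ((K.Λtilde a).domain : Set B) ∧
    Dense (K.adjointDomain a) := by
  open CValued CValued.KSGNS in
  have hN := hreg.denselyDefined
  have hK := nondegenerate_of_truncating hreg.truncating
  have hne := net_neBot hN hK
  have hlim := tendsto_Λtilde hN hK a
  have hdom : ((K.Λtilde a).domain : Set B) = K.convSet (star a * a) := by
    ext b
    rw [SetLike.mem_coe, K.mem_Λtilde_domain]
    constructor
    · rintro ⟨y, hy⟩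
      exact ⟨_, (tendsto_ip_halfVec_iff hN hK a b _).2 (hy.ip B hy)⟩
    · rintro ⟨y, hy⟩
      exact exists_tendsto_halfVec hN hK ((tendsto_ip_halfVec_iff hN hK a b y).1 hy)
  refine ⟨hlim, hdom, ?_, ?_, ?_, ?_, ?_⟩
  · intro ρ hρ S S' hSS hS hT
    have hρH := (mem_F_iff.1 hρ).1
    obtain ⟨R, hR⟩ : ∃ R : AdjOp B E, R.1 = S := ⟨AdjOp.mk S ⟨S', hSS⟩, rfl⟩
    subst hR
    have hRT : star R * R = K.opT ρ := by
      have h1 : S' = (star R).1 := hSS.unique (adjPair_star R)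
      rw [h1, T_eq hρH] at hT
      exact Subtype.ext hT
    obtain ⟨v, hv⟩ := exists_implements_of_le hN hK hρH hRT.le hS
    exact ⟨⟨v, hv, fun w hw => hw.unique hN hK hv⟩,
      fun w hw b => apply_limit_halfVec hN hK (hlim b) hρ hS hRT hw⟩
  · intro b c
    have hact : Tendsto (fun ρ => K.πM a (K.v ρ ((b : B) * c))) K.net
        (𝓝 (HilbertModule.act (K.Λtilde a b) c)) := by
      refine ((hlim b).act c).congr' (eventually_mem_G.mono fun ρ hρ => ?_)
      obtain ⟨v', hv⟩ := (implements_v hN hK (mem_H_of_mem_G hρ)).1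
      rw [← (adjPair_πM hK a).map_act, ← hv.map_act]
      rfl
    have hbc := (K.mem_Λtilde_domain a _).2 ⟨_, hact⟩
    exact ⟨hbc, tendsto_nhds_unique (hlim ⟨_, hbc⟩) hact⟩
  · rw [LinearPMap.IsClosed, graph_Λtilde hN hK]
    refine isClosed_of_closure_subset fun p hp => ?_
    -- These equations hold on the graph and are closed conditions, so they persist on its closure.
    -- Conversely they put `p` in the graph, because `T_ρ^{1/2} → 1` strongly.
    have hp' : ∀ ρ ∈ K.G, (CFC.sqrt (K.opT ρ)).1 p.2 = K.πM a (K.v ρ p.1) := by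
      intro ρ hρ
      have hcl : IsClosed {p : B × E | (CFC.sqrt (K.opT ρ)).1 p.2 = K.πM a (K.v ρ p.1)} :=
        isClosed_eq ((CFC.sqrt (K.opT ρ)).1.continuous.comp continuous_snd)
          ((K.πM a).continuous.comp ((K.v ρ).continuous.comp continuous_fst))
      exact closure_minimal (fun q hq => sqrt_apply_limit_halfVec hN hK hq hρ) hcl hp
    exact (tendsto_sqrt_opT hreg.truncating p.2).congr' (eventually_mem_G.mono hp')
  · rw [hdom]
    exact ha
  · intro x
    refine mem_closure_of_tendsto (tendsto_sqrt_opT hreg.truncating x)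
      (eventually_mem_G.mono fun ρ hρ => ?_)
    obtain ⟨v', hv⟩ := (implements_v hN hK (mem_H_of_mem_G hρ)).1
    -- The vector `T_ρ^{1/2} x` is in the domain of the adjoint, as `⟨Λ(a) b, T_ρ^{1/2} x⟩ = ⟨π(a)
    -- v_ρ b, x⟩`.
    refine ⟨v' (K.πM (star a) x), fun b => ?_⟩
    rw [ip_apply_right, star_sqrt, sqrt_apply_limit_halfVec hN hK (hlim b) hρ, adjPair_πM hK, hv]
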